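/- **Setting.** Let $\Delta$ be a Dynkin diagram of type $\mathsf{ADE}$ with vertex set $\Delta_0$, and let $\sigma$ be an automorphism of $\Delta$ of order $r$ such that no vertex $\imath$ is adjacent to $\sigma(\imath)$. Let $\mathsf P=\bigoplus_\imath\mathbb Z\varpi_\imath$ be the weight lattice, $\alpha_\imath=2\varpi_\imath-\sum_{\jmath\sim\imath}\varpi_\jmath$ the simple roots, $\mathsf Q=\bigoplus_\imath\mathbb Z\alpha_\imath$ the root lattice, $\mathsf R^{+}$ the positive roots, $s_\imath$ the simple reflections; $\sigma$ acts on $\mathsf P$ by $\sigma\varpi_\imath=\varpi_{\sigma(\imath)}$. Let $I$ be the set of $\sigma$-orbits, $\bar\imath$ the orbit of $\imath$, $d_i=|i|$. Write $i\sim j$ if some element of $i$ is adjacent to some element of $j$, and let $c_{ii}=2$, $c_{ij}=-\lceil d_j/d_i\rceil$ if $i\sim j$, and $c_{ij}=0$ otherwise; this is the Cartan matrix of a simple Lie algebra $\mathfrak g$. Fix a $\sigma$-parity function, i.e. integers $0\le\epsilon_\imath<2d_{\bar\imath}$ such that $\epsilon_\imath\equiv\epsilon_{\imath'}\ (2)$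 if $\bar\imath=\bar\imath'$, $\epsilon_{\sigma^l(\imath)}\equiv\epsilon_\imath-2l\ (2d_{\bar\imath})$ for $l\in\mathbb Z$, and $\epsilon_\imath\equiv\epsilon_\jmath+m\ (2m)$ with $m=\min(d_{\bar\imath},d_{\bar\jmath})$ if $\imath\sim\jmath$. A Q-datum is a triple $\mathcal Q=(\Delta,\sigma,\xi)$ with $\xi:\Delta_0\to\mathbb Z$ such that: $|\xi_\imath-\xi_\jmath|=d_{\bar\imath}$ if $\imath\sim\jmath$ and $d_{\bar\imath}=d_{\bar\jmath}$; if $i\sim j$, $d_i<d_j$ and $i=\{\imath\}$, there is a unique $j^\circ\in j$ with $|\xi_\imath-\xi_{j^\circ}|=1$ and $\xi_{\sigma^l(j^\circ)}=\xi_{j^\circ}-2l$ for $0\le l<r$; and $\xi_\imath-\epsilon_\imath\in2d_{\bar\imath}\mathbb Z$ for all $\imath$. Let $\widehat\Delta^\sigma_0=\{(\imath,p)\in\Delta_0\times\mathbb Z: p-\epsilon_\imath\in 2d_{\bar\imath}\mathbb Z\}$ and $\widehat I=\{(i,p)\in I\times\mathbb Z: p-\epsilon_i\in2\mathbb Z\}$,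 where $\epsilon_i\in\{0,1\}$ is the parity of the $\epsilon_\imath$, $\imath\in i$. The map $f(\imath,p)=(\bar\imath,p)$ is a bijection $\widehat\Delta^\sigma_0\to\widehat I$. For a finite $X\subset\widehat\Delta^\sigma_0$ let $w[X]$ be the product of the $s_\imath$, $(\imath,p)\in X$, taken in order of weakly decreasing $p$. For $i\in I$ let $i^\circ\in i$ be the vertex with the largest $\xi$, and put $X^\circ=\{(i^\circ,\xi_{i^\circ})\}_{i\in I}$, $X'=\{(\sigma(i^\circ),p)\in\widehat\Delta_0^\sigma:\xi_{\sigma(i^\circ)}<p\le\xi_{i^\circ}-2\}$, $\tau_{\mathcal Q}=w[X']^{-1}\,w[X^\circ]\,\sigma\,w[X']$ and $\gamma_\imath=(1-\tau_{\mathcal Q}^{d_{\bar\imath}})\varpi_\imath$. Define $\phi_{\mathcal Q}:\widehat\Delta_0^\sigma\to\mathsf R^+\times\mathbb Z$ recursively: $\phi_{\mathcal Q}(\imath,\xi_\imath)=(\gamma_\imath,0)$, and if $\phi_{\mathcal Q}(\imath,p)=(\beta,k)$ and $\beta'=\tau_{\mathcal Q}^{\mp d_{\bar\imath}}\beta$,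 then $\phi_{\mathcal Q}(\imath,p\pm2d_{\bar\imath})$ is $(\beta',k)$ if $\beta'\in\mathsf R^+$ and $(-\beta',k\pm1)$ otherwise. Let $\mathcal M$ be the group of Laurent monomials $m=\prod_{(i,p)\in\widehat I}Y_{i,p}^{u_{i,p}(m)}$. The $\mathcal Q$-weight of $m$ is $\mathrm{wt}_{\mathcal Q}(m)=\sum_{(i,p)}u_{i,p}(m)\,h(\phi_{\mathcal Q}(f^{-1}(i,p)))$, where $h(\alpha,k)=(-1)^k\alpha$. For $(i,p)\in I\times\mathbb Z$ with $(i,p-d_i)\in\widehat I$ let $$A_{i,p}=Y_{i,p-d_i}Y_{i,p+d_i}\prod_{j:c_{ji}=-1}Y_{j,p}^{-1}\prod_{j:c_{ji}=-2}Y_{j,p-1}^{-1}Y_{j,p+1}^{-1}\prod_{j:c_{ji}=-3}Y_{j,p-2}^{-1}Y_{j,p}^{-1}Y_{j,p+2}^{-1},$$ and let $\mathcal M_A\subset\mathcal M$ be the subgroup generated by all these $A_{i,p}$. Let $q_s$ be an indeterminate, $q=q_s^r$, $q_i=q_s^{d_i}$, and $\mathbf k=\overline{\mathbb Q(q)}\ni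 q_s$. Let $U_q(L\mathfrak g)$ be the quantum loop algebra over $\mathbf k$ in Drinfeld's presentation (generators $k_i^{\pm1},x^\pm_{i,n},h_{i,l}$, series $\phi_i^\pm(z)=k_i^{\pm1}\exp(\pm(q_i-q_i^{-1})\sum_{l\ge1}h_{i,\pm l}z^{\pm l})$). For $m\in\mathcal M$ put $\Psi_i(z)=\prod_p(1-q_s^pz)^{u_{i,p}(m)}$; $m$ *occurs* in the $q$-character $\chi_q(V)$ of a module $V$ if there is a nonzero vector on which all coefficients of $\phi_i^\pm(z)-q_i^{\deg\Psi_i}[\Psi_i(q_i^{-1}z)/\Psi_i(q_iz)]^\pm$ ($i\in I$) act nilpotently, where $[\cdot]^\pm$ is the expansion at $z^{\pm1}=0$. Let $\mathscr C^0$ be the Hernandez–Leclerc category; its simple objects are the simple finite-dimensional type $\mathbf 1$ modules whose $\ell$-highest weight is given by a monomial in the $Y_{i,p}$ with nonnegative exponents. A simple $V\in\mathscr C^0$ has (Chari–Moura) elliptic character $\chi\in\mathcal M/\mathcal M_A$, resp. $\mathcal Q$-weight $\beta\in\mathsf Q$, if monomials $m\in\mathcal M$ occur in $\chi_q(V)$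 and all of them satisfy $m\mathcal M_A=\chi$, resp. $\mathrm{wt}_{\mathcal Q}(m)=\beta$. **Proposition.** Let $\mathcal Q$ be any Q-datum. 1. $\mathrm{wt}_{\mathcal Q}(A_{i,p})=0$ for all $(i,p)\in I\times\mathbb Z$ with $(i,p-d_i)\in\widehat I$. 2. $\mathrm{wt}_{\mathcal Q}$ takes values in $\mathsf Q$ and induces an isomorphism of abelian groups $\overline{\mathrm{wt}}_{\mathcal Q}:\mathcal M/\mathcal M_A\xrightarrow{\ \sim\ }\mathsf Q$, $m\mathcal M_A\mapsto\mathrm{wt}_{\mathcal Q}(m)$. 3. Under this isomorphism elliptic characters correspond to $\mathcal Q$-weights: for every simple $V\in\mathscr C^0$ and every $\chi\in\mathcal M/\mathcal M_A$, $V$ has elliptic character $\chi$ if and only if $V$ has $\mathcal Q$-weight $\overline{\mathrm{wt}}_{\mathcal Q}(\chi)$. -/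

import Mathlib

/-! ### Simply-laced Dynkin diagrams with an automorphism -/

namespace QDatum

/-- The graph `Δ` is the Dynkin diagram of the simply-laced Cartan matrix `C`. -/
def HasCartanMatrix {V : Type*} (Δ : SimpleGraph V) {n : ℕ} (C : Matrix (Fin n) (Fin n) ℤ) : Prop :=
  ∃ e : V ≃ Fin n, ∀ v w, Δ.Adj v w ↔ C (e v) (e w) = -1

/-- `Δ` is a Dynkin diagram of type `A_n` (`n ≥ 1`), `D_n` (`n ≥ 4`), `E₆`, `E₇` or `E₈`. -/
def IsADE {V : Type*} (Δ : SimpleGraph V) : Prop :=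
  (∃ n, 1 ≤ n ∧ HasCartanMatrix Δ (CartanMatrix.A n)) ∨
  (∃ n, 4 ≤ n ∧ HasCartanMatrix Δ (CartanMatrix.D n)) ∨
  HasCartanMatrix Δ CartanMatrix.E₆ ∨ HasCartanMatrix Δ CartanMatrix.E₇ ∨
  HasCartanMatrix Δ CartanMatrix.E₈

/-- A pair `(Δ, σ)`: a Dynkin diagram of type ADE on the vertex set `V`, and a diagram automorphism
`σ` such that no vertex is adjacent to its image. -/
structure Folding (V : Type*) where
  Δ : SimpleGraph V
  isADE : IsADE Δ
  σ : Δ ≃g Δ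
  not_adj : ∀ v, ¬ Δ.Adj v (σ v)

variable {V : Type*} [Fintype V] [DecidableEq V]

namespace Folding

variable (F : Folding V)

/-- `σ` as a permutation of the vertices. -/
abbrev perm : Equiv.Perm V := F.σ.toEquiv

/-- The order `r` of `σ`. -/
noncomputable def r : ℕ := orderOf F.perm

/-- The set `I` of `σ`-orbits. -/
abbrev I : Type _ := Quotient (Equiv.Perm.SameCycle.setoid F.perm)

/-- The orbit of a vertex. -/
abbrev orb (v : V) : F.I := Quotient.mk (Equiv.Perm.SameCycle.setoid F.perm) v

noncomputable instance : Fintype F.I := Fintype.ofFinite _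

/-- `d_i` is the cardinality of the orbit `i`. -/
noncomputable def d (i : F.I) : ℕ := Nat.card {v : V // F.orb v = i}

/-- Adjacency of orbits. -/
def orbAdj (i j : F.I) : Prop := ∃ v w, F.orb v = i ∧ F.orb w = j ∧ F.Δ.Adj v w

open Classical in
/-- The Cartan matrix `(c_{ij})` of the folded Lie algebra. -/
noncomputable def c (i j : F.I) : ℤ :=
  if i = j then 2 else if F.orbAdj i j then -⌈(F.d j : ℚ) / (F.d i : ℚ)⌉ else 0

/-! ### Weight lattice, Weyl group and roots of the simply-laced Lie algebra -/

/-- The weight lattice `P`; the weight `∑ λ_v ϖ_v` is the function `v ↦ λ_v`. -/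
abbrev Weight (_ : Folding V) : Type _ := V → ℤ

/-- The fundamental weight `ϖ_v`. -/
def fundWeight (v : V) : F.Weight := Pi.single v 1

open Classical in
/-- The simple root `α_v = 2 ϖ_v - ∑_{w ∼ v} ϖ_w`. -/
noncomputable def simpleRoot (v : V) : F.Weight :=
  (2 : ℤ) • F.fundWeight v - ∑ w with F.Δ.Adj v w, F.fundWeight w

theorem simpleRoot_self (v : V) :
    (LinearMap.proj v : F.Weight →ₗ[ℤ] ℤ) (F.simpleRoot v) = 2 := by
  classical
  have h : ∑ w with F.Δ.Adj v w, (Pi.single w (1 : ℤ) : V → ℤ) v = 0 := by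
    refine Finset.sum_eq_zero fun w hw => ?_
    have hw' : F.Δ.Adj v w := by simpa using hw
    exact Pi.single_eq_of_ne hw'.ne 1
  simp only [simpleRoot, fundWeight, LinearMap.proj_apply, Pi.sub_apply, Pi.smul_apply,
    Pi.single_eq_same, Finset.sum_apply]
  rw [h]; norm_num

/-- The simple reflection `s_v(λ) = λ - (λ, α_v) α_v`, where `(λ, α_v) = λ_v`. -/
noncomputable def s (v : V) : F.Weight ≃ₗ[ℤ] F.Weight := Module.reflection (F.simpleRoot_self v)

/-- The Weyl group `W`. -/
def weylGroup : Subgroup (F.Weight ≃ₗ[ℤ] F.Weight) := Subgroup.closure (Set.range F.s)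

/-- The root lattice `Q`. -/
def rootLattice : AddSubgroup F.Weight := AddSubgroup.closure (Set.range F.simpleRoot)

/-- The positive cone `Q⁺` of the root lattice. -/
def rootCone : AddSubmonoid F.Weight := AddSubmonoid.closure (Set.range F.simpleRoot)

/-- The set of roots `R = W · {α_v}`. -/
def roots : Set F.Weight := {β | ∃ g ∈ F.weylGroup, ∃ v, β = g (F.simpleRoot v)}

/-- The set of positive roots `R⁺ = R ∩ Q⁺`. -/
def posRoots : Set F.Weight := F.roots ∩ F.rootCone

/-- The automorphism of `P` with `ϖ_v ↦ ϖ_{σ v}`. -/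
def sigmaWeight : F.Weight ≃ₗ[ℤ] F.Weight := LinearEquiv.funCongrLeft ℤ ℤ F.perm.symm

end Folding

/-! ### Parity functions, Q-data -/

/-- A `σ`-parity function. -/
structure ParityFunction (F : Folding V) where
  ε : V → ℤ
  nonneg : ∀ v, 0 ≤ ε v
  lt : ∀ v, ε v < 2 * F.d (F.orb v)
  even_orbit : ∀ v w, F.orb v = F.orb w → ε v ≡ ε w [ZMOD 2]
  shift : ∀ (v : V) (l : ℤ), ε ((F.perm ^ l) v) ≡ ε v - 2 * l [ZMOD 2 * F.d (F.orb v)]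
  adj : ∀ v w, F.Δ.Adj v w →
    ε v ≡ ε w + (min (F.d (F.orb v)) (F.d (F.orb w)) : ℕ)
      [ZMOD 2 * (min (F.d (F.orb v)) (F.d (F.orb w)) : ℕ)]

end QDatum

/-- A Q-datum `(Δ, σ, ξ)`, where the height function `ξ` is normalised by the parity function. -/
structure QDatum {V : Type*} [Fintype V] [DecidableEq V] (F : QDatum.Folding V)
    (E : QDatum.ParityFunction F) where
  ξ : V → ℤ
  h1 : ∀ v w, F.Δ.Adj v w → F.d (F.orb v) = F.d (F.orb w) → |ξ v - ξ w| = F.d (F.orb v)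
  h2 : ∀ i j : F.I, F.orbAdj i j → F.d i < F.d j → ∀ v, F.orb v = i →
    ∃! w, F.orb w = j ∧ |ξ v - ξ w| = 1 ∧
      ∀ l : ℕ, l < F.r → ξ ((F.perm ^ l) w) = ξ w - 2 * l
  h3 : ∀ v, (2 * F.d (F.orb v) : ℤ) ∣ ξ v - E.ε v

namespace QDatum

variable {V : Type*} [Fintype V] [DecidableEq V]

/-! ### The repetition quiver and its folding -/

namespace ParityFunction

variable {F : Folding V} (E : ParityFunction F)

/-- The vertices of the repetition quiver, as a set of pairs `(v, p)`. -/
def IsRepVertex (x : V × ℤ) : Prop := (2 * F.d (F.orb x.1) : ℤ) ∣ x.2 - E.ε x.1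

/-- The vertex set of the repetition quiver. -/
abbrev RepVertex : Type _ := {x : V × ℤ // E.IsRepVertex x}

/-- There is an arrow `x → y` in the repetition quiver. -/
def Arrow (x y : V × ℤ) : Prop :=
  E.IsRepVertex x ∧ E.IsRepVertex y ∧ F.Δ.Adj y.1 x.1 ∧
    y.2 - x.2 = (min (F.d (F.orb x.1)) (F.d (F.orb y.1)) : ℕ)

/-- A list enumerating `X` is a compatible reading if no arrow goes from a member of the list to a
later member. -/
def IsCompatibleReading (X : Finset (V × ℤ)) (l : List (V × ℤ)) : Prop :=
  l.Nodup ∧ l.toFinset = X ∧ l.Pairwise fun x y => ¬ E.Arrow x y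

/-- The enumeration of a finite set of pairs `(v, p)` by weakly decreasing `p`. -/
noncomputable def reading (_ : ParityFunction F) (X : Finset (V × ℤ)) : List (V × ℤ) :=
  X.toList.insertionSort fun x y => y.2 ≤ x.2

theorem reading_isCompatible (X : Finset (V × ℤ)) : E.IsCompatibleReading X (E.reading X) := by
  have hp := List.perm_insertionSort (fun x y : V × ℤ => y.2 ≤ x.2) X.toList
  refine ⟨hp.nodup_iff.2 X.nodup_toList, ?_, ?_⟩
  · ext x
    simp [reading, hp.mem_iff]
  · have : Std.Total (fun x y : V × ℤ => y.2 ≤ x.2) := ⟨fun x y => le_total _ _⟩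
    have : IsTrans (V × ℤ) (fun x y : V × ℤ => y.2 ≤ x.2) := ⟨fun _ _ _ h h' => le_trans h' h⟩
    refine (List.pairwise_insertionSort (fun x y : V × ℤ => y.2 ≤ x.2) X.toList).imp ?_
    rintro x y hxy ⟨-, -, -, h⟩
    have hpos : ∀ v, 0 < F.d (F.orb v) := fun v =>
      Nat.card_pos_iff.2 ⟨⟨⟨v, rfl⟩⟩, inferInstance⟩
    have := lt_min (hpos x.1) (hpos y.1)
    omega

/-- The element `w[X]` of the Weyl group: the product of the simple reflections along a compatible
reading of `X`. -/
noncomputable def w (X : Finset (V × ℤ)) : F.Weight ≃ₗ[ℤ] F.Weight :=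
  ((E.reading X).map fun x => F.s x.1).prod

/-- The function `ε : I → {0, 1}` induced by a parity function. -/
def epsOrb (i : F.I) : ℤ :=
  Quotient.lift (fun v => E.ε v % 2) (fun v w h => E.even_orbit v w (Quotient.sound h)) i

/-- Membership of `(i, p)` in `Î`. -/
def MemIhat (i : F.I) (p : ℤ) : Prop := (2 : ℤ) ∣ p - E.epsOrb i

/-- The index set `Î` of the variables `Y_{i,p}`. -/
abbrev Ihat : Type _ := {x : F.I × ℤ // E.MemIhat x.1 x.2}

/-- The folding map from the repetition quiver to `Î`. -/
def fold (x : E.RepVertex) : E.Ihat :=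
  ⟨(F.orb x.1.1, x.1.2), by
    have h1 : (2 : ℤ) ∣ x.1.2 - E.ε x.1.1 := (Dvd.intro _ rfl).trans x.2
    change (2 : ℤ) ∣ x.1.2 - E.ε x.1.1 % 2
    omega⟩

theorem zpow_perm_eq_self (v : V) (l : ℤ) (h : (F.d (F.orb v) : ℤ) ∣ l) :
    (F.perm ^ l) v = v := by
  classical
  have hd : F.d (F.orb v) = Function.minimalPeriod (F.perm • ·) v := by
    rw [MulAction.minimalPeriod_eq_card, Folding.d, ← Nat.card_eq_fintype_card]
    refine Nat.card_congr (Equiv.subtypeEquivRight fun u => ?_)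
    rw [MulAction.mem_orbit_iff]
    constructor
    · intro hu
      obtain ⟨k, hk⟩ := (Quotient.exact hu : F.perm.SameCycle u v).symm
      exact ⟨⟨F.perm ^ k, k, rfl⟩, hk⟩
    · rintro ⟨⟨g, k, rfl⟩, hk⟩
      exact Quotient.sound (Equiv.Perm.SameCycle.symm ⟨k, hk⟩)
  rw [hd] at h
  exact (MulAction.zpow_smul_eq_iff_minimalPeriod_dvd).2 h

theorem fold_bijective : Function.Bijective E.fold := by
  constructor
  · rintro ⟨⟨v, p⟩, hv⟩ ⟨⟨w, p'⟩, hw⟩ h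
    have h' := congrArg Subtype.val h
    obtain ⟨ho, rfl⟩ : F.orb v = F.orb w ∧ p = p' := Prod.mk.inj h'
    obtain ⟨l, rfl⟩ : F.perm.SameCycle v w := Quotient.exact ho
    have hs := (E.shift v l).dvd
    change (2 * F.d (F.orb v) : ℤ) ∣ p - E.ε v at hv
    change (2 * F.d (F.orb ((F.perm ^ l) v)) : ℤ) ∣ p - E.ε ((F.perm ^ l) v) at hw
    rw [← ho] at hw
    have h2 : (2 * F.d (F.orb v) : ℤ) ∣ 2 * l := by
      have := dvd_sub (dvd_sub hw hv) hs
      have e : p - E.ε ((F.perm ^ l) v) - (p - E.ε v) -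
        (E.ε v - 2 * l - E.ε ((F.perm ^ l) v)) = 2 * l := by ring
      rwa [e] at this
    have := zpow_perm_eq_self (F := F) v l (Int.dvd_of_mul_dvd_mul_left two_ne_zero h2)
    simp only [this]
  · rintro ⟨⟨i, p⟩, hp⟩
    induction i using Quotient.inductionOn with | _ v =>
    have hp' : (2 : ℤ) ∣ p - E.ε v % 2 := hp
    obtain ⟨a, ha⟩ : (2 : ℤ) ∣ p - E.ε v := by omega
    have ho : F.orb ((F.perm ^ (-a)) v) = F.orb v :=
      Quotient.sound (Equiv.Perm.SameCycle.symm ⟨-a, rfl⟩)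
    refine ⟨⟨((F.perm ^ (-a)) v, p), ?_⟩, Subtype.ext (Prod.ext ho rfl)⟩
    change (2 * F.d (F.orb ((F.perm ^ (-a)) v)) : ℤ) ∣ p - E.ε ((F.perm ^ (-a)) v)
    rw [ho]
    have hs := (E.shift v (-a)).dvd
    have e : p - E.ε ((F.perm ^ (-a)) v) = E.ε v - 2 * -a - E.ε ((F.perm ^ (-a)) v) := by
      linarith
    rwa [e]

/-- The inverse of the folding map. -/
noncomputable def unfold : E.Ihat ≃ E.RepVertex := (Equiv.ofBijective E.fold E.fold_bijective).symm

/-! ### Laurent monomials -/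

/-- The group `ℳ` of Laurent monomials in the variables `Y_{i,p}`, `(i, p) ∈ Î`, written
additively: `m` is identified with its family of exponents `u_{i,p}(m)`. -/
abbrev Monomial : Type _ := E.Ihat →₀ ℤ

open Classical in
/-- The variable `Y_{i,p}` for `(i, p) ∈ Î` (and the trivial monomial for other pairs, which do not
occur below). -/
noncomputable def Y (i : F.I) (p : ℤ) : E.Monomial :=
  if h : E.MemIhat i p then Finsupp.single ⟨(i, p), h⟩ 1 else 0

open Classical in
/-- The Laurent monomial `A_{i,p}`, for `(i, p - d_i) ∈ Î`. -/
noncomputable def A (i : F.I) (p : ℤ) : E.Monomial :=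
  E.Y i (p - F.d i) + E.Y i (p + F.d i)
    - ∑ j with F.c j i = -1, E.Y j p
    - ∑ j with F.c j i = -2, (E.Y j (p - 1) + E.Y j (p + 1))
    - ∑ j with F.c j i = -3, (E.Y j (p - 2) + E.Y j p + E.Y j (p + 2))

/-- The subgroup `ℳ_A` of `ℳ` generated by the `A_{i,p}`. -/
noncomputable def subgroupA : AddSubgroup E.Monomial :=
  AddSubgroup.closure {m | ∃ i p, E.MemIhat i (p - F.d i) ∧ m = E.A i p}

end ParityFunction

/-! ### The generalized twisted Coxeter element and the `𝒬`-weight -/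

variable {F : Folding V} {E : ParityFunction F} (Q : QDatum F E)

open Classical in
/-- The set of the vertices `i°`: those with the greatest height in their orbit. -/
noncomputable def topVertices : Finset V :=
  {v | ∀ u, F.orb u = F.orb v → Q.ξ u ≤ Q.ξ v}

/-- The set `X° = {(i°, ξ_{i°})}`. -/
noncomputable def Xcirc : Finset (V × ℤ) := Q.topVertices.image fun v => (v, Q.ξ v)

open Classical in
/-- The set `X'` of the vertices `(σ(i°), p)` of the repetition quiver with
`ξ_{σ(i°)} < p ≤ ξ_{i°} - 2`. -/
noncomputable def Xprime : Finset (V × ℤ) :=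
  Q.topVertices.biUnion fun v =>
    ((Finset.Ioc (Q.ξ (F.σ v)) (Q.ξ v - 2)).image fun p => (F.σ v, p)).filter E.IsRepVertex

/-- The twisted Coxeter element `τ° = w[X°] σ`. -/
noncomputable def tauCirc : F.Weight ≃ₗ[ℤ] F.Weight := E.w Q.Xcirc * F.sigmaWeight

/-- The generalized twisted Coxeter element `τ = w[X']⁻¹ τ° w[X']`. -/
noncomputable def tau : F.Weight ≃ₗ[ℤ] F.Weight := (E.w Q.Xprime)⁻¹ * Q.tauCirc * E.w Q.Xprime

/-- `γ_v = (1 - τ ^ {d_v}) ϖ_v`. -/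
noncomputable def gamma (v : V) : F.Weight :=
  F.fundWeight v - (Q.tau ^ F.d (F.orb v)) (F.fundWeight v)

open Classical in
/-- The step `(β, k) = φ(v, p) ↦ φ(v, p + 2 d_v)` of the recursion that defines `φ`. -/
noncomputable def stepUp (v : V) (x : F.Weight × ℤ) : F.Weight × ℤ :=
  let β := (Q.tau ^ (-(F.d (F.orb v) : ℤ))) x.1
  if β ∈ F.posRoots then (β, x.2) else (-β, x.2 + 1)

open Classical in
/-- The step `(β, k) = φ(v, p) ↦ φ(v, p - 2 d_v)` of the recursion that defines `φ`. -/
noncomputable def stepDown (v : V) (x : F.Weight × ℤ) : F.Weight × ℤ :=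
  let β := (Q.tau ^ (F.d (F.orb v) : ℤ)) x.1
  if β ∈ F.posRoots then (β, x.2) else (-β, x.2 - 1)

/-- The map `φ` from the repetition quiver to `R⁺ × ℤ`, with `φ(v, ξ_v) = (γ_v, 0)`. It is written
with target `P × ℤ`. -/
noncomputable def phi (x : E.RepVertex) : F.Weight × ℤ :=
  let n : ℤ := (x.1.2 - Q.ξ x.1.1) / (2 * F.d (F.orb x.1.1))
  if 0 ≤ n then (Q.stepUp x.1.1)^[n.toNat] (Q.gamma x.1.1, 0)
  else (Q.stepDown x.1.1)^[(-n).toNat] (Q.gamma x.1.1, 0)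

/-- The map `φ ∘ f⁻¹` on `Î`, where `f` is the folding map. -/
noncomputable def phiBar (x : E.Ihat) : F.Weight × ℤ := Q.phi (E.unfold x)

/-- `h(α, k) = (-1)^k α`. -/
def signedRoot (x : F.Weight × ℤ) : F.Weight := (x.2.negOnePow : ℤ) • x.1

/-- The `𝒬`-weight homomorphism `m ↦ ∑ u_{i,p}(m) h(φ(f⁻¹(i, p)))`. -/
noncomputable def wt : E.Monomial →+ F.Weight :=
  (Finsupp.linearCombination ℤ fun x : E.Ihat => signedRoot (Q.phiBar x)).toAddMonoidHom

/-! ### Quantum loop algebras -/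

section QuantumLoop

/-- The quantum integer `[n]_a`. -/
def qInt {K : Type*} [Field K] (a : K) (n : ℕ) : K := (a ^ n - a⁻¹ ^ n) / (a - a⁻¹)

/-- The quantum factorial. -/
def qFactorial {K : Type*} [Field K] (a : K) (n : ℕ) : K := ∏ k ∈ Finset.range n, qInt a (k + 1)

/-- The quantum binomial coefficient. -/
def qBinom {K : Type*} [Field K] (a : K) (n k : ℕ) : K :=
  qFactorial a n / (qFactorial a (n - k) * qFactorial a k)

/-- Generators of the quantum loop algebra: `k_i`, `k_i⁻¹`, `x^±_{i,n}` and `h_{i,l}` with `l ≠ 0`.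
Signs are units of `ℤ`. -/
inductive LoopGen (I : Type*)
  | k (i : I)
  | kInv (i : I)
  | x (s : ℤˣ) (i : I) (n : ℤ)
  | h (i : I) (l : {l : ℤ // l ≠ 0})

/-- The index `± l`, for `l ≥ 1`. -/
def signIdx (s : ℤˣ) (l : ℕ) (hl : l ≠ 0) : {l : ℤ // l ≠ 0} :=
  ⟨s * l, mul_ne_zero s.ne_zero (Int.natCast_ne_zero.2 hl)⟩

variable (K : Type*) [Field K] (qs : K) {I : Type*} (c : I → I → ℤ) (d : I → ℕ)

/-- `k_i^{±1}` in the free algebra. -/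
def kGen (s : ℤˣ) (i : I) : FreeAlgebra K (LoopGen I) :=
  FreeAlgebra.ι K (if s = 1 then LoopGen.k i else LoopGen.kInv i)

/-- The generator `x^±_{i,n}` in the free algebra. -/
def xGen (s : ℤˣ) (i : I) (n : ℤ) : FreeAlgebra K (LoopGen I) := FreeAlgebra.ι K (LoopGen.x s i n)

/-- The generator `h_{i,l}` in the free algebra. -/
def hGen (i : I) (l : {l : ℤ // l ≠ 0}) : FreeAlgebra K (LoopGen I) :=
  FreeAlgebra.ι K (LoopGen.h i l)

/-- The power series `± (q_i - q_i⁻¹) ∑_{l ≥ 1} h_{i,±l} u^l` in the variable `u = z^{±1}`, where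
`q_i = q_s^{d_i}`. -/
def hSeries (s : ℤˣ) (i : I) : PowerSeries (FreeAlgebra K (LoopGen I)) :=
  PowerSeries.mk fun l =>
    if hl : l = 0 then 0
    else (((s : ℤ) : K) * (qs ^ d i - (qs ^ d i)⁻¹)) • hGen K i (signIdx s l hl)

/-- The coefficient `φ^±_{i,±n}` (`n ≥ 0`) of `u^n`, `u = z^{±1}`, in
`φ^±_i(z) = k_i^{±1} exp(± (q_i - q_i⁻¹) ∑_{l ≥ 1} h_{i,±l} z^{±l})`. As the series in the
exponential has no constant term, only its powers up to the `n`-th contribute. -/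
noncomputable def phiNat (s : ℤˣ) (i : I) (n : ℕ) : FreeAlgebra K (LoopGen I) :=
  kGen K s i * ∑ a ∈ Finset.range (n + 1),
    ((a.factorial : K)⁻¹) • PowerSeries.coeff n (hSeries K qs d s i ^ a)

/-- The coefficient of `z^n` in `φ^±_i(z)`, for `n ∈ ℤ`. -/
noncomputable def phiInt (s : ℤˣ) (i : I) (n : ℤ) : FreeAlgebra K (LoopGen I) :=
  if 0 ≤ (s : ℤ) * n then phiNat K qs d s i n.natAbs else 0

/-- The element
`∑_g ∑_k (-1)^k [1-c_{ij} choose k]_i x_{i,n_{g(1)}} ⋯ x_{i,n_{g(k)}} x_{j,l} x_{i,n_{g(k+1)}} ⋯`,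
i.e. a coefficient of the left-hand side of the Drinfeld–Serre relation. -/
noncomputable def serreElt (s : ℤˣ) (i j : I) (n : Fin (1 - c i j).toNat → ℤ) (l : ℤ) :
    FreeAlgebra K (LoopGen I) :=
  ∑ g : Equiv.Perm (Fin (1 - c i j).toNat), ∑ k ∈ Finset.range ((1 - c i j).toNat + 1),
    ((-1 : K) ^ k * qBinom (qs ^ d i) (1 - c i j).toNat k) •
      ((((List.finRange (1 - c i j).toNat).take k).map fun a => xGen K s i (n (g a))).prod *
        xGen K s j l *
        (((List.finRange (1 - c i j).toNat).drop k).map fun a => xGen K s i (n (g a))).prod)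

open Classical in
/-- The defining relations of the quantum loop algebra in Drinfeld's presentation. Relations between
formal series are written coefficientwise. -/
inductive LoopRel : FreeAlgebra K (LoopGen I) → FreeAlgebra K (LoopGen I) → Prop
  | k_kInv (i : I) : LoopRel (kGen K 1 i * kGen K (-1) i) 1
  | kInv_k (i : I) : LoopRel (kGen K (-1) i * kGen K 1 i) 1
  | k_k (i j : I) : LoopRel (kGen K 1 i * kGen K 1 j) (kGen K 1 j * kGen K 1 i)
  | k_x (s : ℤˣ) (i j : I) (n : ℤ) :
      LoopRel (kGen K 1 i * xGen K s j n * kGen K (-1) i)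
        ((qs ^ d i) ^ ((s : ℤ) * c i j) • xGen K s j n)
  | k_h (i j : I) (l : {l : ℤ // l ≠ 0}) :
      LoopRel (kGen K 1 i * hGen K j l) (hGen K j l * kGen K 1 i)
  | h_h (i j : I) (l m : {l : ℤ // l ≠ 0}) :
      LoopRel (hGen K i l * hGen K j m) (hGen K j m * hGen K i l)
  | x_pos_neg (i j : I) (m n : ℤ) :
      LoopRel (xGen K 1 i m * xGen K (-1) j n - xGen K (-1) j n * xGen K 1 i m)
        (if i = j then (qs ^ d i - (qs ^ d i)⁻¹)⁻¹ •
          (phiInt K qs d 1 i (m + n) - phiInt K qs d (-1) i (m + n)) else 0)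
  | x_x (s : ℤˣ) (i j : I) (m n : ℤ) :
      LoopRel
        ((qs ^ d i) ^ ((s : ℤ) * c i j) • (xGen K s i m * xGen K s j (n + 1)) -
          xGen K s i (m + 1) * xGen K s j n)
        (xGen K s j (n + 1) * xGen K s i m -
          (qs ^ d i) ^ ((s : ℤ) * c i j) • (xGen K s j n * xGen K s i (m + 1)))
  | phi_x (t s : ℤˣ) (i j : I) (m n : ℤ) :
      LoopRel
        ((qs ^ d i) ^ ((s : ℤ) * c i j) • (phiInt K qs d t i m * xGen K s j (n + 1)) -
          phiInt K qs d t i (m + 1) * xGen K s j n)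
        (xGen K s j (n + 1) * phiInt K qs d t i m -
          (qs ^ d i) ^ ((s : ℤ) * c i j) • (xGen K s j n * phiInt K qs d t i (m + 1)))
  | serre (s : ℤˣ) (i j : I) (hij : i ≠ j) (n : Fin (1 - c i j).toNat → ℤ) (l : ℤ) :
      LoopRel (serreElt K qs c d s i j n l) 0

/-- The quantum loop algebra attached to the Cartan matrix `c` with symmetrizer `d`, over a field
`K` with a parameter `q_s`. -/
abbrev LoopAlgebra : Type _ := RingQuot (LoopRel K qs c d)

/-- The quotient map from the free algebra. -/
noncomputable def toLoop : FreeAlgebra K (LoopGen I) →ₐ[K] LoopAlgebra K qs c d :=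
  RingQuot.mkAlgHom K (LoopRel K qs c d)

end QuantumLoop

/-! ### Modules, `q`-characters and elliptic characters -/

/-- The field `𝐤`: an algebraic closure of `ℚ(q_s)`. With `q = q_s ^ r` it is an algebraic closure of
`ℚ(q)`. -/
abbrev BaseField : Type := AlgebraicClosure (RatFunc ℚ)

/-- The parameter `q_s = q^{1/r}`. -/
noncomputable def qs : BaseField := algebraMap (RatFunc ℚ) BaseField RatFunc.X

namespace Folding

variable (F : Folding V)

/-- The quantum loop algebra `U_q(L𝔤)`. -/
abbrev U : Type _ := LoopAlgebra BaseField qs F.c F.d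

/-- `q_i = q_s^{d_i}`. -/
noncomputable def q (i : F.I) : BaseField := qs ^ F.d i

/-- The element `k_i`. -/
noncomputable def kElt (i : F.I) : F.U := toLoop BaseField qs F.c F.d (kGen BaseField 1 i)

/-- The element `x^±_{i,n}`. -/
noncomputable def xElt (s : ℤˣ) (i : F.I) (n : ℤ) : F.U :=
  toLoop BaseField qs F.c F.d (xGen BaseField s i n)

/-- The coefficient `φ^±_{i,±n}` of `z^{±n}` in `φ^±_i(z)`, `n ≥ 0`. -/
noncomputable def phiElt (s : ℤˣ) (i : F.I) (n : ℕ) : F.U :=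
  toLoop BaseField qs F.c F.d (phiNat BaseField qs F.d s i n)

/-- `L` is finite-dimensional of type `1`: each `k_i` acts diagonalizably with eigenvalues in
`q_i^ℤ`. -/
def IsTypeOne (L : Type*) [AddCommGroup L] [Module BaseField L] [Module F.U L]
    [IsScalarTower BaseField F.U L] : Prop :=
  FiniteDimensional BaseField L ∧ ∀ i : F.I,
    ⨆ n : ℤ, Module.End.eigenspace (Algebra.lsmul BaseField BaseField L (F.kElt i)) (F.q i ^ n) = ⊤

end Folding

namespace ParityFunction

variable {F : Folding V} (E : ParityFunction F)

open Classical in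
/-- For the tuple of rational functions `Ψ_i(z) = ∏_p (1 - q_s^p z)^{u_{i,p}(m)}` attached to `m`
(that is, `Y_{i,p}` is sent to the tuple with `i`-th entry `1 - q_s^p z` and all other entries `1`):
the value of `Ψ_i(q_i⁻¹ z) / Ψ_i(q_i z)` at `z = t`. -/
noncomputable def ratio (m : E.Monomial) (i : F.I) (t : RatFunc BaseField) : RatFunc BaseField :=
  m.prod fun x u =>
    if x.1.1 = i then
      ((1 - RatFunc.C (qs ^ x.1.2 * (F.q i)⁻¹) * t) / (1 - RatFunc.C (qs ^ x.1.2 * F.q i) * t)) ^ u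
    else 1

open Classical in
/-- The degree of `Ψ_i(z)`. -/
noncomputable def deg (m : E.Monomial) (i : F.I) : ℤ :=
  m.sum fun x u => if x.1.1 = i then u else 0

/-- The coefficient of `z^{±n}` in `q_i^{deg Ψ_i} [Ψ_i(q_i⁻¹ z) / Ψ_i(q_i z)]^±`, where `[·]^±` is
the Laurent expansion at `z^{±1} = 0`; for the lower sign one substitutes `z = t⁻¹` and expands at
`t = 0`. -/
noncomputable def lEigenvalue (m : E.Monomial) (s : ℤˣ) (i : F.I) (n : ℕ) : BaseField :=
  F.q i ^ E.deg m i *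
    (((E.ratio m i (RatFunc.X ^ (s : ℤ)) : RatFunc BaseField) : LaurentSeries BaseField).coeff n)

section Modules

variable (L : Type*) [AddCommGroup L] [Module BaseField L] [Module F.U L]

/-- The monomial `m` occurs in the `q`-character of `L`: the subspace of `L` on which all the
operators `φ^±_{i,±n}` minus the corresponding eigenvalues act nilpotently is not zero. -/
def Occurs (m : E.Monomial) : Prop :=
  ∃ v : L, v ≠ 0 ∧ ∀ (s : ℤˣ) (i : F.I) (n : ℕ), ∃ N : ℕ,
    (F.phiElt s i n - algebraMap BaseField F.U (E.lEigenvalue m s i n)) ^ N • v = 0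

/-- `L` has `ℓ`-highest weight `m`: a nonzero vector is annihilated by all the `x^+_{i,n}` and is an
eigenvector of the `φ^±_{i,±n}` with the eigenvalues given by `m`. -/
def HasHighestWeight (m : E.Monomial) : Prop :=
  ∃ v : L, v ≠ 0 ∧ (∀ (i : F.I) (n : ℤ), F.xElt 1 i n • v = 0) ∧
    ∀ (s : ℤˣ) (i : F.I) (n : ℕ), F.phiElt s i n • v = E.lEigenvalue m s i n • v

/-- `L` is a simple object of the category `𝒞⁰`: a simple finite-dimensional module of type `1`
isomorphic to `L(m)` for some monomial `m` in the `Y_{i,p}` with nonnegative exponents. -/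
def IsSimpleC0 [IsScalarTower BaseField F.U L] : Prop :=
  IsSimpleModule F.U L ∧ F.IsTypeOne L ∧ ∃ m : E.Monomial, 0 ≤ m ∧ E.HasHighestWeight L m

/-- `L` has elliptic character `χ ∈ ℳ/ℳ_A`: some monomial occurs in the `q`-character of `L`, and
every such monomial belongs to the class `χ`. -/
def HasEllipticCharacter (χ : E.Monomial ⧸ E.subgroupA) : Prop :=
  (∃ m : E.Monomial, E.Occurs L m) ∧
    ∀ m : E.Monomial, E.Occurs L m → (m : E.Monomial ⧸ E.subgroupA) = χ

end Modules

end ParityFunction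

/-- `L` has `𝒬`-weight `β`: some monomial occurs in the `q`-character of `L`, and every such monomial
has `𝒬`-weight `β`. -/
def HasWeight (L : Type*) [AddCommGroup L] [Module BaseField L] [Module F.U L] (β : F.Weight) :
    Prop :=
  (∃ m : E.Monomial, E.Occurs L m) ∧ ∀ m : E.Monomial, E.Occurs L m → Q.wt m = β

end QDatum

/-! A change of coordinates on the weight lattice removes the Q-datum from the formula for the
weight. Cut the repetition quiver into layers of constant height `p`. Adjacent vertices of `Δ` never
share a layer, so the reflections of one layer commute; let `layer p` be their product and
`transport p` the running product, normalised by `transport (p - 1) = transport p * layer p`. Since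
`σ` shifts the quiver by `-2`, there is an element `coxeter` with `coxeter * transport p = transport
(p - 2) * σ`.

Reflecting along a region between two slices of the quiver leads from one slice to the other
(`mul_prod_fundWeight`). The sets `X'` and `X°` are such regions: they lie below a slice whose
heights are consecutive in each orbit, and end at `ξ` and at the `σ`-translate of that slice. This
yields an automorphism `g` preserving the root lattice with `g τ g⁻¹ = coxeter` and `g ϖ_v =
transport (ξ v) ϖ_v` (`exists_conj_coxeter`). It takes the weight of the variable at `(v, p)` to
`transport p ϖ_v - transport (p - 1) ϖ_v = transport p α_v` (`map_signedRoot_phi`).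

In this form the weight of `A_{i,p}` vanishes by the additivity relation for `ϖ_v - α_v`, applied at
heights `p + d_i` and `p - d_i`: the terms at `v` match the sum over the neighbours, and the change
of each neighbour over this window of heights is what the Cartan integers `-1, -2, -3` record
(`sum_orbit`, `map_A`).

For the isomorphism, the relations `A_{i,p}` express every variable through those of one slice, so
`ℳ/ℳ_A` has `|V|` generators. The image is the whole root lattice, which is free of rank `|V|`;
hence these generators have independent images and the kernel is exactly `ℳ_A`. Elliptic characters
and weights then correspond formally.

The ADE hypothesis supplies the nondegeneracy of the Cartan matrix and the bound `d_i ≤ 3`. The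
latter makes the single raised vertex per orbit in `X'` sufficient. -/

set_option linter.unusedSectionVars false

namespace QDatum

/-! ### Dynkin diagrams of type ADE as paths with a leaf attached -/

/-- `Δ` is a path on `n + 1` vertices together with one more vertex, adjacent precisely to the
`b`-th vertex of the path. -/
def IsPathWithLeaf {V : Type*} (Δ : SimpleGraph V) (n b : ℕ) : Prop :=
  ∃ e : V ≃ Option (Fin (n + 1)),
    (∀ i j, Δ.Adj (e.symm (some i)) (e.symm (some j)) ↔ (i : ℕ) + 1 = j ∨ (j : ℕ) + 1 = i) ∧
    ∀ i, Δ.Adj (e.symm none) (e.symm (some i)) ↔ (i : ℕ) = b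

theorem HasCartanMatrix.isPathWithLeaf {V : Type*} {Δ : SimpleGraph V} {n b : ℕ}
    {C : Matrix (Fin (n + 2)) (Fin (n + 2)) ℤ} (h : HasCartanMatrix Δ C) (p : Fin (n + 2))
    (h1 : ∀ i j, C (p.succAbove i) (p.succAbove j) = -1 ↔ (i : ℕ) + 1 = j ∨ (j : ℕ) + 1 = i)
    (h2 : ∀ i, C p (p.succAbove i) = -1 ↔ (i : ℕ) = b) : IsPathWithLeaf Δ n b := by
  obtain ⟨e, he⟩ := h
  refine ⟨e.trans (finSuccEquiv' p), fun i j => ?_, fun i => ?_⟩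
  · rw [he, ← h1]; simp
  · rw [he, ← h2]; simp

/-- A diagram with more than one vertex is a star with arms of `a`, `c` and `1` vertices. The
inequality says that its Cartan determinant, `2(a+1) + 2(c+1) - (a+1)(c+1)`, is not zero. -/
theorem IsADE.subsingleton_or_isPathWithLeaf {V : Type*} {Δ : SimpleGraph V} (h : IsADE Δ) :
    (Nonempty V ∧ Subsingleton V) ∨
      ∃ a c : ℕ, 2 * (a + 1) + 2 * (c + 1) ≠ (a + 1) * (c + 1) ∧ IsPathWithLeaf Δ (a + c) a := by
  rcases h with ⟨n, hn, h⟩ | ⟨n, hn, h⟩ | h | h | h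
  · obtain rfl | ⟨m, rfl⟩ : n = 1 ∨ ∃ m, n = m + 2 := by
      rcases n with _ | _ | m
      · omega
      · exact Or.inl rfl
      · exact Or.inr ⟨m, rfl⟩
    · obtain ⟨e, -⟩ := h
      exact Or.inl ⟨⟨e.symm 0⟩, e.subsingleton⟩
    · refine Or.inr ⟨m, 0, by omega, h.isPathWithLeaf (Fin.last _) (fun i j => ?_) fun i => ?_⟩
      · simp only [CartanMatrix.A, Matrix.of_apply, Fin.succAbove_last, Fin.ext_iff,
          Fin.val_castSucc]
        split_ifs <;> simp <;> omega
      · have := i.2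
        simp only [CartanMatrix.A, Matrix.of_apply, Fin.succAbove_last, Fin.ext_iff,
          Fin.val_castSucc, Fin.val_last]
        split_ifs <;> simp <;> omega
  · obtain ⟨m, rfl⟩ : ∃ m, n = m + 4 := ⟨n - 4, by omega⟩
    refine Or.inr ⟨m + 1, 1, by omega, h.isPathWithLeaf (Fin.last _) (fun i j => ?_) fun i => ?_⟩
    · have := i.2
      have := j.2
      simp only [CartanMatrix.D, Matrix.of_apply, Fin.succAbove_last, Fin.ext_iff,
        Fin.val_castSucc]
      split_ifs <;> simp <;> omega
    · have := i.2
      simp only [CartanMatrix.D, Matrix.of_apply, Fin.succAbove_last, Fin.ext_iff,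
        Fin.val_castSucc, Fin.val_last]
      split_ifs <;> (simp_all; try omega)
  -- In Bourbaki's labelling, counted from `0`, vertex `1` is the short arm; the others form a path
  -- whose branch vertex is in position `2`.
  · exact Or.inr ⟨2, 2, by decide, h.isPathWithLeaf 1 (by decide) (by decide)⟩
  · exact Or.inr ⟨2, 3, by decide, h.isPathWithLeaf 1 (by decide) (by decide)⟩
  · exact Or.inr ⟨2, 4, by decide, h.isPathWithLeaf 1 (by decide) (by decide)⟩

/-- The values of `x` along the path, shifted by one, and extended by zero. -/
def pathValue {n : ℕ} (x : Option (Fin (n + 1)) → ℤ) : ℕ → ℤ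
  | 0 => 0
  | k + 1 => if h : k < n + 1 then x (some ⟨k, h⟩) else 0

theorem pathValue_succ {n : ℕ} (x : Option (Fin (n + 1)) → ℤ) (i : Fin (n + 1)) :
    pathValue x (i + 1) = x (some i) := by
  simp [pathValue, i.2]

/-- The zeros just outside the path stand for the missing neighbours of its ends, so one formula
covers all positions. -/
theorem sum_neighbors_path {n : ℕ} (x : Option (Fin (n + 1)) → ℤ) (i : Fin (n + 1)) :
    ∑ j : Fin (n + 1), (if (i : ℕ) + 1 = j ∨ (j : ℕ) + 1 = i then x (some j) else 0) =
      pathValue x i + pathValue x (i + 2) := by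
  have h : ∀ j : Fin (n + 1), (if (i : ℕ) + 1 = j ∨ (j : ℕ) + 1 = i then x (some j) else 0) =
      (if (j : ℕ) + 1 = i then pathValue x (j + 1) else 0) +
        if (i : ℕ) + 1 = j then pathValue x (j + 1) else 0 := by
    intro j
    rw [pathValue_succ]
    split_ifs <;> omega
  simp_rw [h]
  rw [Finset.sum_add_distrib]
  congr 1
  · obtain ⟨i, hi⟩ := i
    rcases i with _ | i
    · simp [pathValue]
    · rw [Finset.sum_eq_single ⟨i, by omega⟩]
      · simp
      · intro j _ hj
        rw [if_neg]
        intro h'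
        exact hj (Fin.ext (by simpa using h'))
      · simp
  · by_cases hi : (i : ℕ) + 1 < n + 1
    · rw [Finset.sum_eq_single ⟨i + 1, hi⟩]
      · simp
      · intro j _ hj
        rw [if_neg]
        intro h'
        exact hj (Fin.ext h'.symm)
      · simp
    · rw [Finset.sum_eq_zero]
      · simp [pathValue, hi]
      · intro j _
        rw [if_neg]
        have := j.2
        omega

section

variable {V : Type*} [Fintype V] {Δ : SimpleGraph V} {n b : ℕ} {e : V ≃ Option (Fin (n + 1))}

open Classical in
theorem sum_neighbors_some
    (h1 : ∀ i j, Δ.Adj (e.symm (some i)) (e.symm (some j)) ↔ (i : ℕ) + 1 = j ∨ (j : ℕ) + 1 = i)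
    (h2 : ∀ i, Δ.Adj (e.symm none) (e.symm (some i)) ↔ (i : ℕ) = b) (x : V → ℤ)
    (i : Fin (n + 1)) :
    ∑ w with Δ.Adj (e.symm (some i)) w, x w =
      pathValue (x ∘ e.symm) i + pathValue (x ∘ e.symm) (i + 2) +
        if (i : ℕ) = b then x (e.symm none) else 0 := by
  rw [Finset.sum_filter, ← e.symm.sum_comp, Fintype.sum_option, add_comm]
  simp only [h1, Δ.adj_comm _ (e.symm none), h2]
  rw [← sum_neighbors_path]
  rfl

open Classical in
theorem sum_neighbors_none
    (h2 : ∀ i, Δ.Adj (e.symm none) (e.symm (some i)) ↔ (i : ℕ) = b) (hb : b ≤ n) (x : V → ℤ) :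
    ∑ w with Δ.Adj (e.symm none) w, x w = pathValue (x ∘ e.symm) (b + 1) := by
  rw [Finset.sum_filter, ← e.symm.sum_comp, Fintype.sum_option]
  simp only [h2]
  rw [Finset.sum_eq_single ⟨b, by omega⟩]
  · simp [pathValue, show b < n + 1 by omega]
  · intro j _ hj
    rw [if_neg]
    intro h'
    exact hj (Fin.ext h')
  · simp

end

/-! ### Consequences of the classification: connectedness, degrees, nondegeneracy -/

variable {V : Type*} {Δ : SimpleGraph V}

theorem IsADE.preconnected (h : IsADE Δ) : Δ.Preconnected := by
  rcases h.subsingleton_or_isPathWithLeaf with ⟨-, hs⟩ | ⟨a, c, -, e, h1, h2⟩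
  · intro u v
    rw [Subsingleton.elim u v]
  · have hp : ∀ k (hk : k < a + c + 1),
        Δ.Reachable (e.symm (some ⟨a, by omega⟩)) (e.symm (some ⟨k, hk⟩)) := by
      have h0 : ∀ k (hk : k < a + c + 1),
          Δ.Reachable (e.symm (some ⟨0, by omega⟩)) (e.symm (some ⟨k, hk⟩)) := by
        intro k
        induction k with
        | zero => exact fun _ => SimpleGraph.Reachable.refl _
        | succ k ih =>
          exact fun hk => (ih (by omega)).trans ((h1 _ _).2 (Or.inl rfl)).reachable
      exact fun k hk => (h0 a (by omega)).symm.trans (h0 k hk)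
    have hall : ∀ v, Δ.Reachable (e.symm (some ⟨a, by omega⟩)) v := by
      intro v
      obtain ⟨o, rfl⟩ := e.symm.surjective v
      rcases o with _ | k
      · exact ((h2 ⟨a, by omega⟩).2 rfl).symm.reachable
      · exact hp k k.2
    exact fun u v => (hall u).symm.trans (hall v)

-- The diagram is a tree, so this is `2|V| - 2|E| = 2`. As degrees are `σ`-invariant, it restricts
-- the possible orbit sizes.
open Classical in
theorem IsADE.sum_two_sub_degree [Fintype V] (h : IsADE Δ) :
    ∑ v, (2 - ∑ w with Δ.Adj v w, (1 : ℤ)) = 2 := by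
  rcases h.subsingleton_or_isPathWithLeaf with ⟨hn, hs⟩ | ⟨a, c, -, e, h1, h2⟩
  · obtain ⟨v⟩ := hn
    have : ∀ w, w = v := fun w => Subsingleton.elim _ _
    have hu : (Finset.univ : Finset V) = {v} := by ext; simp [this]
    rw [hu]
    simp [Finset.filter_singleton]
  · have hsum : ∑ i : Fin (a + c + 1), ∑ w with Δ.Adj (e.symm (some i)) w, (1 : ℤ) =
        2 * (a + c) + 1 := by
      simp_rw [sum_neighbors_some h1 h2]
      rw [Finset.sum_add_distrib, Finset.sum_add_distrib]
      have e1 : ∑ i : Fin (a + c + 1), (if (i : ℕ) = a then (1 : ℤ) else 0) = 1 := by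
        rw [Finset.sum_eq_single ⟨a, by omega⟩]
        · simp
        · intro j _ hj
          rw [if_neg]
          intro h'
          exact hj (Fin.ext h')
        · simp
      have e2 : ∑ i : Fin (a + c + 1), pathValue ((fun _ => (1 : ℤ)) ∘ e.symm) i = a + c := by
        rw [Fin.sum_univ_succ]
        have : ∀ i : Fin (a + c),
            pathValue ((fun _ => (1 : ℤ)) ∘ e.symm) (i.succ : Fin (a + c + 1)) = 1 := by
          intro i
          have := i.2
          simp [pathValue, show (i : ℕ) < a + c + 1 by omega]
        simp_rw [this]
        simp [pathValue]
      have e3 : ∑ i : Fin (a + c + 1), pathValue ((fun _ => (1 : ℤ)) ∘ e.symm) (i + 2) = a + c := by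
        rw [Fin.sum_univ_castSucc]
        have : ∀ i : Fin (a + c),
            pathValue ((fun _ => (1 : ℤ)) ∘ e.symm) ((i.castSucc : Fin (a + c + 1)) + 2) = 1 := by
          intro i
          have := i.2
          simp [pathValue]
        simp_rw [this]
        simp [pathValue]
      rw [e1, e2, e3]
      ring
    rw [← e.symm.sum_comp, Fintype.sum_option, Finset.sum_sub_distrib, hsum,
      sum_neighbors_none h2 (by omega)]
    simp [pathValue, show a < a + c + 1 by omega]
    ring

open Classical in
/-- A vertex with at least three neighbours has exactly three, one of which is a leaf. -/
theorem IsADE.card_neighbors [Fintype V] (h : IsADE Δ) (v : V)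
    (hv : 3 ≤ (Finset.univ.filter (Δ.Adj v)).card) :
    (Finset.univ.filter (Δ.Adj v)).card = 3 ∧ ∃ w, Δ.Adj v w ∧ ∀ u, Δ.Adj w u → u = v := by
  rcases h.subsingleton_or_isPathWithLeaf with ⟨-, hs⟩ | ⟨a, c, -, e, h1, h2⟩
  · have := (Finset.univ.filter (Δ.Adj v)).card_le_univ
    have := Fintype.card_le_one_iff_subsingleton.2 hs
    omega
  have hcard : ((Finset.univ.filter (Δ.Adj v)).card : ℤ) = ∑ w with Δ.Adj v w, (1 : ℤ) := by simp
  have hle : ∀ k, pathValue ((fun _ => (1 : ℤ)) ∘ e.symm) k ≤ 1 := by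
    intro k
    rcases k with _ | k
    · simp [pathValue]
    · simp only [pathValue, Function.comp]
      split_ifs <;> simp
  obtain ⟨o, rfl⟩ := e.symm.surjective v
  rcases o with _ | i
  · rw [sum_neighbors_none h2 (by omega)] at hcard
    have := hle (a + 1)
    omega
  · rw [sum_neighbors_some h1 h2] at hcard
    have ha := hle i
    have hb := hle (i + 2)
    split_ifs at hcard with hi
    · refine ⟨by omega, e.symm none, ((h2 _).2 hi).symm, fun u hu => ?_⟩
      obtain ⟨o, rfl⟩ := e.symm.surjective u
      rcases o with _ | j
      · exact absurd hu (Δ.irrefl)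
      · rw [h2] at hu
        rw [Fin.ext (hu.trans hi.symm)]
    · omega

open Classical in
/-- The Cartan matrix is nondegenerate. -/
theorem IsADE.eq_zero_of_two_mul_eq_sum [Fintype V] (h : IsADE Δ) (x : V → ℤ)
    (hx : ∀ v, 2 * x v = ∑ w with Δ.Adj v w, x w) : x = 0 := by
  rcases h.subsingleton_or_isPathWithLeaf with ⟨-, hs⟩ | ⟨a, c, hac, e, h1, h2⟩
  · funext v
    have : (Finset.univ.filter (Δ.Adj v)) = ∅ := by
      ext w
      simp [Subsingleton.elim w v]
    have h2 := hx v
    rw [this, Finset.sum_empty] at h2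
    simpa using h2
  have hz : 2 * x (e.symm none) = pathValue (x ∘ e.symm) (a + 1) := by
    rw [hx, sum_neighbors_none h2 (by omega)]
  have hp : ∀ k, k < a + c + 1 → 2 * pathValue (x ∘ e.symm) (k + 1) =
      pathValue (x ∘ e.symm) k + pathValue (x ∘ e.symm) (k + 2) +
        if k = a then x (e.symm none) else 0 := by
    intro k hk
    have := hx (e.symm (some ⟨k, hk⟩))
    rw [sum_neighbors_some h1 h2] at this
    rw [← this]
    simp [pathValue, hk]
  have hend : pathValue (x ∘ e.symm) (a + c + 2) = 0 := by simp [pathValue]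
  have hx0 : ∀ k (hk : k < a + c + 1),
      x (e.symm (some ⟨k, hk⟩)) = pathValue (x ∘ e.symm) (k + 1) := by
    intro k hk
    simp [pathValue, hk]
  set y := pathValue (x ∘ e.symm) with hy
  have hy0 : y 0 = 0 := rfl
  -- On each side of the branch vertex the equations say that `y` is affine, and it vanishes just
  -- beyond both ends.
  have hl : ∀ k, k ≤ a → y k = k * y 1 ∧ y (k + 1) = (k + 1) * y 1 := by
    intro k
    induction k with
    | zero => intro _; simp [hy0]
    | succ k ih =>
      intro hk
      obtain ⟨i1, i2⟩ := ih (by omega)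
      refine ⟨by push_cast; linarith, ?_⟩
      have := hp k (by omega)
      rw [if_neg (by omega)] at this
      push_cast
      have e : y (k + 1 + 1) = y (k + 2) := rfl
      linarith
  have hr : ∀ k, k ≤ c → y (a + c + 2 - k) = k * y (a + c + 1) ∧
      y (a + c + 1 - k) = (k + 1) * y (a + c + 1) := by
    intro k
    induction k with
    | zero => intro _; simp [hend]
    | succ k ih =>
      intro hk
      obtain ⟨i1, i2⟩ := ih (by omega)
      have e0 : a + c + 2 - (k + 1) = a + c + 1 - k := by omega
      refine ⟨by rw [e0]; push_cast; linarith, ?_⟩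
      have := hp (a + c - k) (by omega)
      rw [if_neg (by omega)] at this
      have e1 : a + c - k + 1 = a + c + 1 - k := by omega
      have e2 : a + c - k + 2 = a + c + 2 - k := by omega
      have e3 : a + c + 1 - (k + 1) = a + c - k := by omega
      rw [e1, e2] at this
      rw [e3]
      push_cast
      linarith
  obtain ⟨l1, l2⟩ := hl a le_rfl
  obtain ⟨r1, r2⟩ := hr c le_rfl
  rw [show a + c + 2 - c = a + 2 by omega] at r1
  rw [show a + c + 1 - c = a + 1 by omega] at r2
  have hm := hp a (by omega)
  rw [if_pos rfl] at hm
  -- Eliminating the leaf and both arms leaves one equation at the branch vertex, whose coefficient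
  -- is the Cartan determinant.
  have key : ((2 * (a + 1) + 2 * (c + 1) : ℤ) - (a + 1) * (c + 1)) * y (a + 1) = 0 := by
    linear_combination (2 * (a + 1) * (c + 1) : ℤ) * hm + ((a + 1) * (c + 1) : ℤ) * hz +
      (2 * (a + 1) * (c + 1) : ℤ) * (l1 + r1) - (2 * a * (c + 1) : ℤ) * l2 -
      (2 * (a + 1) * c : ℤ) * r2
  have hne : ((2 * (a + 1) + 2 * (c + 1) : ℤ) - (a + 1) * (c + 1)) ≠ 0 := by
    intro h0
    apply hac
    zify
    linarith
  have hya : y (a + 1) = 0 := (mul_eq_zero.1 key).resolve_left hne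
  have hy1 : y 1 = 0 := by
    have : ((a + 1 : ℤ)) * y 1 = 0 := by linarith
    exact (mul_eq_zero.1 this).resolve_left (by positivity)
  have hyn : y (a + c + 1) = 0 := by
    have : ((c + 1 : ℤ)) * y (a + c + 1) = 0 := by linarith
    exact (mul_eq_zero.1 this).resolve_left (by positivity)
  funext v
  obtain ⟨o, rfl⟩ := e.symm.surjective v
  rcases o with _ | ⟨k, hk⟩
  · simp only [Pi.zero_apply]
    omega
  · rw [hx0]
    by_cases hka : k ≤ a
    · rw [(hl k hka).2, hy1, mul_zero]; rfl
    · have := (hr (a + c - k) (by omega)).2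
      rw [show a + c + 1 - (a + c - k) = k + 1 by omega] at this
      rw [this, hyn, mul_zero]; rfl

end QDatum

namespace QDatum

variable {V : Type*} [Fintype V] [DecidableEq V]

namespace Folding

variable (F : Folding V)

/-! ### Orbits -/

theorem d_pos (v : V) : 0 < F.d (F.orb v) := Nat.card_pos_iff.2 ⟨⟨⟨v, rfl⟩⟩, inferInstance⟩

theorem d_pos' (i : F.I) : 0 < F.d i := by
  induction i using Quotient.inductionOn with | _ v => exact F.d_pos v

theorem orb_zpow (v : V) (l : ℤ) : F.orb ((F.perm ^ l) v) = F.orb v :=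
  Quotient.sound (Equiv.Perm.SameCycle.symm ⟨l, rfl⟩)

theorem orb_perm (v : V) : F.orb (F.perm v) = F.orb v := by simpa using F.orb_zpow v 1

theorem exists_zpow_of_orb_eq {v w : V} (h : F.orb v = F.orb w) : ∃ l : ℤ, (F.perm ^ l) v = w :=
  Quotient.exact h

theorem adj_perm {v w : V} : F.Δ.Adj (F.perm v) (F.perm w) ↔ F.Δ.Adj v w := F.σ.map_adj_iff

theorem adj_zpow (l : ℤ) {v w : V} :
    F.Δ.Adj ((F.perm ^ l) v) ((F.perm ^ l) w) ↔ F.Δ.Adj v w := by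
  induction l using Int.induction_on generalizing v w with
  | zero => simp
  | succ l ih => rw [add_comm, zpow_add, zpow_one, Equiv.Perm.mul_apply, Equiv.Perm.mul_apply,
      adj_perm, ih]
  | pred l ih =>
    rw [← F.adj_perm, ← Equiv.Perm.mul_apply, ← Equiv.Perm.mul_apply, ← zpow_one_add]
    simpa using ih

/-! ### Simple roots and reflections -/

open Classical in
theorem simpleRoot_apply (v w : V) :
    F.simpleRoot v w = (if w = v then 2 else 0) - if F.Δ.Adj v w then 1 else 0 := by
  simp [simpleRoot, fundWeight, Pi.single_apply, Finset.sum_apply]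

theorem simpleRoot_perm (v w : V) : F.simpleRoot (F.perm v) (F.perm w) = F.simpleRoot v w := by
  simp only [simpleRoot_apply, F.perm.injective.eq_iff]
  congr 1
  by_cases h : F.Δ.Adj v w
  · rw [if_pos h, if_pos (F.adj_perm.2 h)]
  · rw [if_neg h, if_neg (mt F.adj_perm.1 h)]

theorem s_apply (v : V) (x : F.Weight) : F.s v x = x - x v • F.simpleRoot v :=
  Module.reflection_apply _ _

theorem s_fundWeight_ne {u v : V} (h : u ≠ v) : F.s v (F.fundWeight u) = F.fundWeight u := by
  simp [s_apply, fundWeight, h.symm]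

theorem s_fundWeight_self (v : V) :
    F.s v (F.fundWeight v) = F.fundWeight v - F.simpleRoot v := by
  simp [s_apply, fundWeight]

open Classical in
theorem fundWeight_sub_simpleRoot (v : V) : F.fundWeight v - F.simpleRoot v =
    ∑ w with F.Δ.Adj v w, F.fundWeight w - F.fundWeight v := by
  rw [simpleRoot, two_smul]; abel

theorem weight_eq_sum (x : F.Weight) : x = ∑ v, x v • F.fundWeight v := by
  funext w
  simp [fundWeight, Pi.single_apply, Finset.sum_apply]

theorem linearEquiv_ext {f g : F.Weight ≃ₗ[ℤ] F.Weight}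
    (h : ∀ v, f (F.fundWeight v) = g (F.fundWeight v)) : f = g := by
  ext1 x
  rw [F.weight_eq_sum x]
  rw [map_sum, map_sum]
  exact Finset.sum_congr rfl fun v _ => by rw [map_zsmul, map_zsmul, h]

theorem sigmaWeight_apply (x : F.Weight) (v : V) : F.sigmaWeight x v = x (F.perm.symm v) := rfl

theorem sigmaWeight_fundWeight (v : V) :
    F.sigmaWeight (F.fundWeight v) = F.fundWeight (F.perm v) := by
  funext w
  simp [sigmaWeight_apply, fundWeight, Pi.single_apply, Equiv.symm_apply_eq]

theorem sigmaWeight_simpleRoot (v : V) :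
    F.sigmaWeight (F.simpleRoot v) = F.simpleRoot (F.perm v) := by
  funext w
  obtain ⟨w, rfl⟩ := F.perm.surjective w
  rw [sigmaWeight_apply, Equiv.symm_apply_apply, simpleRoot_perm]

theorem sigmaWeight_zpow_fundWeight (l : ℤ) (v : V) :
    (F.sigmaWeight ^ l) (F.fundWeight v) = F.fundWeight ((F.perm ^ l) v) := by
  induction l using Int.induction_on generalizing v with
  | zero => simp
  | succ l ih =>
    rw [zpow_add_one, zpow_add_one, LinearEquiv.mul_apply, sigmaWeight_fundWeight, ih]
    rfl
  | pred l ih =>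
    obtain ⟨w, rfl⟩ := F.perm.surjective v
    rw [← sigmaWeight_fundWeight, ← LinearEquiv.mul_apply, ← zpow_add_one, sub_add_cancel, ih,
      ← Equiv.Perm.mul_apply, ← zpow_add_one, sub_add_cancel]

/-! ### The stabilizer of the root lattice -/

/-- The group of automorphisms of the weight lattice that preserve the root lattice. -/
def rootLatticeStabilizer : Subgroup (F.Weight ≃ₗ[ℤ] F.Weight) where
  carrier := {g | ∀ x, g x ∈ F.rootLattice ↔ x ∈ F.rootLattice}
  one_mem' := fun _ => Iff.rfl
  mul_mem' := fun {f g} hf hg x => (hf (g x)).trans (hg x)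
  inv_mem' := fun {g} hg x => by
    rw [← hg]
    simp

theorem simpleRoot_mem_rootLattice (v : V) : F.simpleRoot v ∈ F.rootLattice :=
  AddSubgroup.subset_closure ⟨v, rfl⟩

theorem mem_stabilizer_of_sub_mem {g : F.Weight ≃ₗ[ℤ] F.Weight}
    (h : ∀ x, g x - x ∈ F.rootLattice) : g ∈ F.rootLatticeStabilizer := fun x =>
  ⟨fun hx => by simpa using sub_mem hx (h x), fun hx => by simpa using add_mem (h x) hx⟩

theorem s_mem_stabilizer (v : V) : F.s v ∈ F.rootLatticeStabilizer :=
  F.mem_stabilizer_of_sub_mem fun x => by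
    rw [s_apply, sub_sub_cancel_left]
    exact neg_mem (zsmul_mem (F.simpleRoot_mem_rootLattice v) _)

theorem map_mem_rootLattice {g : F.Weight →ₗ[ℤ] F.Weight}
    (h : ∀ v, g (F.simpleRoot v) ∈ F.rootLattice) {x : F.Weight} (hx : x ∈ F.rootLattice) :
    g x ∈ F.rootLattice := by
  have : F.rootLattice ≤ F.rootLattice.comap g.toAddMonoidHom := by
    rw [rootLattice, AddSubgroup.closure_le]
    rintro _ ⟨v, rfl⟩
    exact h v
  exact this hx

theorem sigmaWeight_mem_stabilizer : F.sigmaWeight ∈ F.rootLatticeStabilizer := by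
  intro x
  constructor
  · intro hx
    have := F.map_mem_rootLattice (g := F.sigmaWeight.symm.toLinearMap) (fun v => ?_) hx
    · simpa using this
    · obtain ⟨w, rfl⟩ := F.perm.surjective v
      rw [← sigmaWeight_simpleRoot]
      simpa using F.simpleRoot_mem_rootLattice w
  · refine F.map_mem_rootLattice (g := F.sigmaWeight.toLinearMap) fun v => ?_
    simpa [sigmaWeight_simpleRoot] using F.simpleRoot_mem_rootLattice (F.perm v)

end Folding

namespace ParityFunction

variable {F : Folding V} (E : ParityFunction F)

/-! ### Vertices of the repetition quiver -/

theorem isRepVertex_iff {v : V} {p : ℤ} :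
    E.IsRepVertex (v, p) ↔ (2 * F.d (F.orb v) : ℤ) ∣ p - E.ε v := Iff.rfl

theorem isRepVertex_zpow (v : V) (p l : ℤ) :
    E.IsRepVertex ((F.perm ^ l) v, p - 2 * l) ↔ E.IsRepVertex (v, p) := by
  rw [isRepVertex_iff, isRepVertex_iff, F.orb_zpow]
  have e : p - 2 * l - E.ε ((F.perm ^ l) v) =
    (p - E.ε v) + (E.ε v - 2 * l - E.ε ((F.perm ^ l) v)) := by ring
  rw [e, dvd_add_left (E.shift v l).dvd]

theorem isRepVertex_perm (v : V) (p : ℤ) :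
    E.IsRepVertex (F.perm v, p - 2) ↔ E.IsRepVertex (v, p) := by
  simpa using E.isRepVertex_zpow v p 1

variable {E}

theorem IsRepVertex.dvd_sub {v : V} {p q : ℤ} (hp : E.IsRepVertex (v, p))
    (hq : E.IsRepVertex (v, q)) : (2 * F.d (F.orb v) : ℤ) ∣ p - q := by
  have := _root_.dvd_sub hp hq
  simpa using this

theorem IsRepVertex.of_dvd_sub {v : V} {p q : ℤ} (hp : E.IsRepVertex (v, p))
    (h : (2 * F.d (F.orb v) : ℤ) ∣ p - q) : E.IsRepVertex (v, q) := by
  have := _root_.dvd_sub hp h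
  rw [isRepVertex_iff]
  simpa using this

theorem IsRepVertex.add_le {v : V} {p q : ℤ} (hp : E.IsRepVertex (v, p))
    (hq : E.IsRepVertex (v, q)) (h : q < p) : q + 2 * F.d (F.orb v) ≤ p := by
  have := Int.le_of_dvd (by omega) (hp.dvd_sub hq)
  omega

/-- The power `σ ^ d_w` fixes `w` and moves the edge to another edge at `w`. Comparing the two
parity congruences with the shift rule gives `2 d_w ≡ 0` modulo `2 d_v` when `d_v ≤ d_w`. -/
theorem min_d_dvd (E : ParityFunction F) {v w : V} (h : F.Δ.Adj v w) :
    min (F.d (F.orb v)) (F.d (F.orb w)) ∣ F.d (F.orb w) := by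
  rcases le_total (F.d (F.orb w)) (F.d (F.orb v)) with hle | hle
  · rw [min_eq_right hle]
  · have h1 := (E.adj v w h).dvd
    have h2 := (F.adj_zpow (F.d (F.orb w))).2 h
    rw [zpow_perm_eq_self w _ dvd_rfl] at h2
    have h3 := (E.adj _ _ h2).dvd
    have h4 := (E.shift v (F.d (F.orb w))).dvd
    rw [F.orb_zpow] at h3
    rw [min_eq_left hle] at h1 h3 ⊢
    have h5 := dvd_add (_root_.dvd_sub h1 h3) h4
    have e : ∀ x y z a b : ℤ, x + a - y - (x + a - z) + (y - 2 * b - z) = -(2 * b) := by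
      intros; ring
    rw [e, dvd_neg] at h5
    exact Int.natCast_dvd_natCast.1 (Int.dvd_of_mul_dvd_mul_left two_ne_zero h5)

/-- The minimum `m` of the two orbit sizes divides both, so all congruences may be reduced modulo
`2m`. Heights over adjacent vertices differ by an odd multiple of `m`, in particular they are never
equal. -/
theorem IsRepVertex.adj_dvd {v w : V} {p q : ℤ} (hp : E.IsRepVertex (v, p))
    (hq : E.IsRepVertex (w, q)) (h : F.Δ.Adj v w) :
    (2 * (min (F.d (F.orb v)) (F.d (F.orb w)) : ℕ) : ℤ) ∣
      p - q - (min (F.d (F.orb v)) (F.d (F.orb w)) : ℕ) := by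
  have h1 : (2 * F.d (F.orb v) : ℤ) ∣ p - E.ε v := hp
  have h2 : (2 * F.d (F.orb w) : ℤ) ∣ q - E.ε w := hq
  have h3 := (E.adj v w h).dvd
  have h4 := E.min_d_dvd h
  have h5 := E.min_d_dvd h.symm
  rw [min_comm] at h5
  generalize (min (F.d (F.orb v)) (F.d (F.orb w)) : ℕ) = m at *
  have h1' := (mul_dvd_mul_left (2 : ℤ) (Int.natCast_dvd_natCast.2 h5)).trans h1
  have h2' := (mul_dvd_mul_left (2 : ℤ) (Int.natCast_dvd_natCast.2 h4)).trans h2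
  have e : p - q - m = p - E.ε v - (q - E.ε w) - (E.ε w + m - E.ε v) := by ring
  rw [e]
  exact _root_.dvd_sub (_root_.dvd_sub h1' h2') h3

theorem IsRepVertex.ne_of_adj {v w : V} {p q : ℤ} (hp : E.IsRepVertex (v, p))
    (hq : E.IsRepVertex (w, q)) (h : F.Δ.Adj v w) : p ≠ q := by
  rintro rfl
  have := hp.adj_dvd hq h
  have h1 := lt_min (F.d_pos v) (F.d_pos w)
  rw [sub_self, zero_sub, dvd_neg] at this
  have := Int.le_of_dvd (by omega) this
  omega

variable (E)

/-! ### The layers of the repetition quiver -/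

open Classical in
/-- The product of the pairwise commuting reflections `s_v` over the vertices `(v, p)` of the
repetition quiver with given `p`, as a linear map. -/
noncomputable def layerMap (p : ℤ) : F.Weight →ₗ[ℤ] F.Weight :=
  LinearMap.id - ∑ v with E.IsRepVertex (v, p), (LinearMap.proj v).smulRight (F.simpleRoot v)

open Classical in
theorem layerMap_apply (p : ℤ) (x : F.Weight) :
    E.layerMap p x = x - ∑ v with E.IsRepVertex (v, p), x v • F.simpleRoot v := by
  simp [layerMap, LinearMap.sum_apply]

/-- No two vertices of a layer are adjacent, so subtracting the multiples of all the simple roots at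
once negates each coordinate in the layer, and a second application undoes the first. -/
theorem layerMap_involutive (p : ℤ) : Function.Involutive (E.layerMap p) := by
  classical
  intro x
  have h : ∀ v, E.IsRepVertex (v, p) → E.layerMap p x v = - x v := by
    intro v hv
    rw [layerMap_apply, Pi.sub_apply, Finset.sum_apply, Finset.sum_eq_single v]
    · simp [F.simpleRoot_apply]; ring
    · intro w hw hwv
      have hw' : E.IsRepVertex (w, p) := by simpa using hw
      have : ¬ F.Δ.Adj w v := fun h => hw'.ne_of_adj hv h rfl
      simp [F.simpleRoot_apply, hwv.symm, this]
    · simp [hv]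
  rw [E.layerMap_apply p (E.layerMap p x),
    Finset.sum_congr rfl fun v hv => by rw [h v (by simpa using hv)], layerMap_apply]
  simp

/-- The product of the pairwise commuting reflections `s_v` over the vertices `(v, p)` of the
repetition quiver with given `p`. -/
noncomputable def layer (p : ℤ) : F.Weight ≃ₗ[ℤ] F.Weight :=
  LinearEquiv.ofInvolutive (E.layerMap p) (E.layerMap_involutive p)

open Classical in
theorem layer_apply (p : ℤ) (x : F.Weight) :
    E.layer p x = x - ∑ v with E.IsRepVertex (v, p), x v • F.simpleRoot v := E.layerMap_apply p x

theorem layer_fundWeight_of_mem {v : V} {p : ℤ} (h : E.IsRepVertex (v, p)) :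
    E.layer p (F.fundWeight v) = F.fundWeight v - F.simpleRoot v := by
  classical
  rw [layer_apply, Finset.sum_eq_single v]
  · simp [Folding.fundWeight]
  · intro w _ hw
    simp [Folding.fundWeight, hw]
  · simp [h]

theorem layer_fundWeight_of_not_mem {v : V} {p : ℤ} (h : ¬ E.IsRepVertex (v, p)) :
    E.layer p (F.fundWeight v) = F.fundWeight v := by
  classical
  rw [layer_apply, Finset.sum_eq_zero, sub_zero]
  intro w hw
  have : w ≠ v := by
    rintro rfl
    exact h (by simpa using hw)
  simp [Folding.fundWeight, this]

theorem layer_mem_stabilizer (p : ℤ) : E.layer p ∈ F.rootLatticeStabilizer :=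
  F.mem_stabilizer_of_sub_mem fun x => by
    rw [layer_apply, sub_sub_cancel_left]
    exact neg_mem (sum_mem fun v _ => zsmul_mem (F.simpleRoot_mem_rootLattice v) _)

/-- The map `(v, p) ↦ (σ v, p - 2)` is a symmetry of the repetition quiver. -/
theorem sigmaWeight_mul_layer (p : ℤ) :
    F.sigmaWeight * E.layer p = E.layer (p - 2) * F.sigmaWeight := by
  refine F.linearEquiv_ext fun v => ?_
  rw [LinearEquiv.mul_apply, LinearEquiv.mul_apply, F.sigmaWeight_fundWeight]
  by_cases h : E.IsRepVertex (v, p)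
  · rw [E.layer_fundWeight_of_mem h, E.layer_fundWeight_of_mem ((E.isRepVertex_perm v p).2 h),
      map_sub, F.sigmaWeight_fundWeight, F.sigmaWeight_simpleRoot]
  · rw [E.layer_fundWeight_of_not_mem h,
      E.layer_fundWeight_of_not_mem (mt (E.isRepVertex_perm v p).1 h), F.sigmaWeight_fundWeight]

theorem sigmaWeight_zpow_mul_layer (k p : ℤ) :
    F.sigmaWeight ^ k * E.layer p = E.layer (p - 2 * k) * F.sigmaWeight ^ k := by
  induction k using Int.induction_on generalizing p with
  | zero => simp
  | succ k ih =>
    rw [zpow_add_one, mul_assoc, sigmaWeight_mul_layer, ← mul_assoc, ih, mul_assoc]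
    congr 2; ring
  | pred k ih =>
    have h : F.sigmaWeight⁻¹ * E.layer p = E.layer (p + 2) * F.sigmaWeight⁻¹ := by
      rw [inv_mul_eq_iff_eq_mul, ← mul_assoc, sigmaWeight_mul_layer, mul_assoc, mul_inv_cancel,
        mul_one, add_sub_cancel_right]
    rw [zpow_sub_one, mul_assoc, h, ← mul_assoc, ih, mul_assoc]
    congr 2; ring

/-! ### Transport along the layers -/

/-- The product of two consecutive layers and of `σ`. -/
noncomputable def coxeter : F.Weight ≃ₗ[ℤ] F.Weight := E.layer 0 * E.layer (-1) * F.sigmaWeight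

/-- The product of all the layers between the `p`-th and the `0`-th, for `p` negative; it is
extended to all integers so that `transport (p - 1) = transport p * layer p`. -/
noncomputable def transport (p : ℤ) : F.Weight ≃ₗ[ℤ] F.Weight :=
  E.coxeter ^ (-((p + 1) / 2)) * F.sigmaWeight ^ ((p + 1) / 2) *
    if 2 ∣ p then 1 else E.layer (p + 1)

theorem transport_even (k : ℤ) :
    E.transport (2 * k) = E.coxeter ^ (-k) * F.sigmaWeight ^ k := by
  rw [transport, if_pos (Dvd.intro _ rfl), mul_one, show (2 * k + 1) / 2 = k by omega]

theorem transport_odd (k : ℤ) :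
    E.transport (2 * k - 1) = E.coxeter ^ (-k) * F.sigmaWeight ^ k * E.layer (2 * k) := by
  rw [transport, if_neg (by omega), sub_add_cancel, show 2 * k / 2 = k by omega]

/-- Every layer is a `σ`-translate of `layer 0` or `layer (-1)`, so an even layer followed by the
next one contributes exactly one factor `coxeter`, up to a power of `σ`. -/
theorem transport_sub_one (p : ℤ) : E.transport (p - 1) = E.transport p * E.layer p := by
  obtain ⟨k, rfl | rfl⟩ : ∃ k, p = 2 * k ∨ p = 2 * k - 1 := ⟨(p + 1) / 2, by omega⟩
  · rw [transport_odd, transport_even]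
  · rw [transport_odd, show 2 * k - 1 - 1 = 2 * (k - 1) by ring, transport_even]
    rw [mul_assoc (E.coxeter ^ (-k)), E.sigmaWeight_zpow_mul_layer, sub_self, mul_assoc, mul_assoc,
      E.sigmaWeight_zpow_mul_layer, show 2 * k - 1 - 2 * k = -1 by ring,
      show -(k - 1) = -k + 1 by ring, zpow_add_one, mul_assoc]
    congr 1
    rw [coxeter, zpow_sub_one]
    group

/-- This equivariance lets powers of `coxeter` act as shifts of height; on `ϖ_v` a shift by `2 d_v`
leaves no trace of `σ`. -/
theorem coxeter_mul_transport (p : ℤ) :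
    E.coxeter * E.transport p = E.transport (p - 2) * F.sigmaWeight := by
  obtain ⟨k, rfl | rfl⟩ : ∃ k, p = 2 * k ∨ p = 2 * k - 1 := ⟨(p + 1) / 2, by omega⟩
  · rw [transport_even, show 2 * k - 2 = 2 * (k - 1) by ring, transport_even]
    group
  · rw [transport_odd, show 2 * k - 1 - 2 = 2 * (k - 1) - 1 by ring, transport_odd]
    rw [mul_assoc (_ * _) (E.layer _), show 2 * (k - 1) = 2 * k - 2 by ring,
      ← sigmaWeight_mul_layer]
    group

theorem coxeter_zpow_mul_transport (k p : ℤ) :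
    E.coxeter ^ k * E.transport p = E.transport (p - 2 * k) * F.sigmaWeight ^ k := by
  induction k using Int.induction_on generalizing p with
  | zero => simp
  | succ k ih =>
    rw [zpow_add_one, mul_assoc, coxeter_mul_transport, ← mul_assoc, ih, zpow_add_one, ← mul_assoc]
    congr 3; ring
  | pred k ih =>
    have h : E.coxeter⁻¹ * E.transport p = E.transport (p + 2) * F.sigmaWeight⁻¹ := by
      rw [inv_mul_eq_iff_eq_mul, ← mul_assoc, coxeter_mul_transport, mul_assoc, mul_inv_cancel,
        mul_one, add_sub_cancel_right]
    rw [zpow_sub_one, mul_assoc, h, ← mul_assoc, ih, zpow_sub_one, ← mul_assoc]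
    congr 3; ring

theorem coxeter_mem_stabilizer : E.coxeter ∈ F.rootLatticeStabilizer :=
  mul_mem (mul_mem (E.layer_mem_stabilizer _) (E.layer_mem_stabilizer _))
    F.sigmaWeight_mem_stabilizer

theorem transport_mem_stabilizer (p : ℤ) : E.transport p ∈ F.rootLatticeStabilizer := by
  refine mul_mem (mul_mem (zpow_mem E.coxeter_mem_stabilizer _)
    (zpow_mem F.sigmaWeight_mem_stabilizer _)) ?_
  split_ifs
  · exact one_mem _
  · exact E.layer_mem_stabilizer _

theorem transport_sub_one_fundWeight {v : V} {p : ℤ} (h : E.IsRepVertex (v, p)) :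
    E.transport (p - 1) (F.fundWeight v) =
      E.transport p (F.fundWeight v) - E.transport p (F.simpleRoot v) := by
  rw [transport_sub_one, LinearEquiv.mul_apply, E.layer_fundWeight_of_mem h, map_sub]

open Classical in
/-- Additivity. -/
theorem transport_add_transport_sub_one {v : V} {p : ℤ} (h : E.IsRepVertex (v, p)) :
    E.transport p (F.fundWeight v) + E.transport (p - 1) (F.fundWeight v) =
      ∑ w with F.Δ.Adj v w, E.transport p (F.fundWeight w) := by
  rw [transport_sub_one, LinearEquiv.mul_apply, E.layer_fundWeight_of_mem h,
    F.fundWeight_sub_simpleRoot, map_sub, map_sum]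
  abel

/-- Only reflections at `v` move `ϖ_v`, and there are none strictly between consecutive heights over
`v`. -/
theorem transport_fundWeight_eq {v : V} {h p : ℤ} (hv : E.IsRepVertex (v, h)) (h1 : h ≤ p)
    (h2 : p < h + 2 * F.d (F.orb v)) :
    E.transport p (F.fundWeight v) = E.transport h (F.fundWeight v) := by
  obtain ⟨n, rfl⟩ := Int.le.dest h1
  induction n with
  | zero => simp
  | succ n ih =>
    rw [← ih (by omega) (by push_cast at h2 ⊢; omega)]
    have e : h + (n : ℕ) = h + (n + 1 : ℕ) - 1 := by push_cast; ring
    rw [e, transport_sub_one, LinearEquiv.mul_apply, E.layer_fundWeight_of_not_mem]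
    intro hw
    have := hw.add_le hv (by omega)
    omega

theorem transport_sub_fundWeight {v : V} {p : ℤ} (h : E.IsRepVertex (v, p)) :
    E.transport (p - 2 * F.d (F.orb v)) (F.fundWeight v) =
      E.transport (p - 1) (F.fundWeight v) := by
  have := F.d_pos v
  refine (E.transport_fundWeight_eq (h.of_dvd_sub ?_) (by omega) (by omega)).symm
  simp

/-! ### Slices -/

/-- A slice of the repetition quiver: one vertex `(v, H v)` for each `v`, neighbours being
consecutive. -/
def IsSlice (H : V → ℤ) : Prop :=
  (∀ v, E.IsRepVertex (v, H v)) ∧ ∀ v w, F.Δ.Adj v w → H v < H w + 2 * F.d (F.orb w)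

/-- The slice of the vertices `(v, p)` with `p ≤ T` maximal. -/
noncomputable def level (T : ℤ) (v : V) : ℤ := T - (T - E.ε v) % (2 * F.d (F.orb v))

theorem isRepVertex_level (T : ℤ) (v : V) : E.IsRepVertex (v, E.level T v) := by
  rw [isRepVertex_iff, level, sub_right_comm]
  exact Int.dvd_self_sub_emod

theorem level_le (T : ℤ) (v : V) : E.level T v ≤ T := by
  have := Int.emod_nonneg (T - E.ε v)
    (b := 2 * F.d (F.orb v)) (by have := F.d_pos v; omega)
  rw [level]
  omega

theorem lt_level_add (T : ℤ) (v : V) : T < E.level T v + 2 * F.d (F.orb v) := by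
  have := Int.emod_lt_of_pos (T - E.ε v)
    (b := 2 * F.d (F.orb v)) (by have := F.d_pos v; omega)
  rw [level]
  omega

theorem isSlice_level (T : ℤ) : E.IsSlice (E.level T) :=
  ⟨E.isRepVertex_level T, fun v w _ => (E.level_le T v).trans_lt (E.lt_level_add T w)⟩

theorem transport_level (T : ℤ) (v : V) :
    E.transport (E.level T v) (F.fundWeight v) = E.transport T (F.fundWeight v) :=
  (E.transport_fundWeight_eq (E.isRepVertex_level T v) (E.level_le T v) (E.lt_level_add T v)).symm

/-- The passage from a slice to a lower one, along the vertices in between. -/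
theorem mul_prod_fundWeight {η : V → ℤ} (hη : E.IsSlice η) (l : List (V × ℤ)) :
    ∀ (H : V → ℤ) (g : F.Weight ≃ₗ[ℤ] F.Weight), E.IsSlice H → (∀ v, η v ≤ H v) → l.Nodup →
      l.Pairwise (fun x y => y.2 ≤ x.2) →
      (∀ v p, (v, p) ∈ l ↔ E.IsRepVertex (v, p) ∧ η v < p ∧ p ≤ H v) →
      (∀ v, g (F.fundWeight v) = E.transport (H v) (F.fundWeight v)) →
      ∀ v, (g * (l.map fun x => F.s x.1).prod) (F.fundWeight v) =
        E.transport (η v) (F.fundWeight v) := by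
  induction l with
  | nil =>
    intro H g hH hle _ _ hl hg v
    have : H v = η v := by
      by_contra hne
      have := (hl v (H v)).2 ⟨hH.1 v, lt_of_le_of_ne (hle v) (Ne.symm hne), le_rfl⟩
      simp at this
    simp [hg, this]
  | cons x l ih =>
    classical
    intro H g hH hle hnd hpw hl hg u
    obtain ⟨v, p⟩ := x
    obtain ⟨hrep, hlt, hpH⟩ := (hl v p).1 List.mem_cons_self
    rw [List.nodup_cons] at hnd
    rw [List.pairwise_cons] at hpw
    have hmax : ∀ w q, E.IsRepVertex (w, q) → η w < q → q ≤ H w → q ≤ p := by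
      intro w q h1 h2 h3
      rcases List.mem_cons.1 ((hl w q).2 ⟨h1, h2, h3⟩) with h | h
      · rw [(Prod.mk.inj h).2]
      · exact hpw.1 _ h
    obtain rfl : p = H v :=
      le_antisymm hpH (hmax v _ (hH.1 v) (hlt.trans_le hpH) le_rfl)
    have hd := F.d_pos v
    have hηv : η v + 2 * F.d (F.orb v) ≤ H v := hrep.add_le (hη.1 v) hlt
    have hrep' : E.IsRepVertex (v, H v - 2 * F.d (F.orb v)) := hrep.of_dvd_sub (by simp)
    -- The first vertex of the list is the highest one still to be crossed. A neighbour with nothing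
    -- left to cross already sits on `η`, and the slice condition for `η` keeps it below `H v`.
    have hnb : ∀ w, F.Δ.Adj v w → H w < H v := by
      intro w hw
      have hne := (hH.1 v).ne_of_adj (hH.1 w) hw
      by_cases h : η w < H w
      · exact lt_of_le_of_ne (hmax w _ (hH.1 w) h le_rfl) hne.symm
      · have := hη.2 w v hw.symm
        have := hle w
        omega
    have hH' : E.IsSlice (Function.update H v (H v - 2 * F.d (F.orb v))) := by
      constructor
      · intro w
        by_cases h : w = v
        · subst h
          simpa using hrep'
        · simpa [h] using hH.1 w
      · intro w w' hww
        by_cases h : w = v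
        · subst h
          have := hH.2 _ _ hww
          rw [Function.update_self, Function.update_of_ne hww.ne']
          omega
        · by_cases h' : w' = v
          · subst h'
            have := hnb w hww.symm
            rw [Function.update_self, Function.update_of_ne hww.ne]
            omega
          · rw [Function.update_of_ne h, Function.update_of_ne h']
            exact hH.2 _ _ hww
    have key := ih (Function.update H v (H v - 2 * F.d (F.orb v))) (g * F.s v) hH' ?_ hnd.2 hpw.2
      ?_ ?_ u
    · rw [List.map_cons, List.prod_cons, ← mul_assoc]
      exact key
    · intro w
      by_cases h : w = v
      · subst h
        rw [Function.update_self]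
        omega
      · simpa [h] using hle w
    · intro w q
      by_cases h : w = v
      · subst h
        rw [Function.update_self]
        constructor
        · intro hq
          obtain ⟨h1, h2, h3⟩ := (hl w q).1 (List.mem_cons_of_mem _ hq)
          have hne : q ≠ H w := by
            rintro rfl
            exact hnd.1 hq
          have := hrep.add_le h1 (lt_of_le_of_ne h3 hne)
          exact ⟨h1, h2, by omega⟩
        · rintro ⟨h1, h2, h3⟩
          rcases List.mem_cons.1 ((hl w q).2 ⟨h1, h2, by omega⟩) with h | h
          · have := (Prod.mk.inj h).2
            omega
          · exact h
      · rw [Function.update_of_ne h, ← hl w q, List.mem_cons]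
        simp [h]
    · intro w
      by_cases h : w = v
      · subst h
        -- Both the reflection and the layer replace `ϖ_w` by the sum over the neighbours minus
        -- `ϖ_w`. Each neighbour lies less than one of its periods below `H w`, so its transported
        -- weight may be read at height `H w`.
        rw [Function.update_self, E.transport_sub_fundWeight hrep, LinearEquiv.mul_apply,
          F.s_fundWeight_self, transport_sub_one, LinearEquiv.mul_apply,
          E.layer_fundWeight_of_mem hrep, F.fundWeight_sub_simpleRoot, map_sub, map_sub, map_sum,
          map_sum, hg]
        congr 1
        refine Finset.sum_congr rfl fun w' hw' => ?_
        have hw' : F.Δ.Adj w w' := by simpa using hw'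
        rw [hg, E.transport_fundWeight_eq (hH.1 w') (hnb w' hw').le (hH.2 _ _ hw')]
      · rw [Function.update_of_ne h, LinearEquiv.mul_apply, F.s_fundWeight_ne h, hg]

theorem mul_w_fundWeight {η H : V → ℤ} (hη : E.IsSlice η) (hH : E.IsSlice H)
    (hle : ∀ v, η v ≤ H v) {X : Finset (V × ℤ)}
    (hX : ∀ v p, (v, p) ∈ X ↔ E.IsRepVertex (v, p) ∧ η v < p ∧ p ≤ H v)
    {g : F.Weight ≃ₗ[ℤ] F.Weight}
    (hg : ∀ v, g (F.fundWeight v) = E.transport (H v) (F.fundWeight v)) (v : V) :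
    (g * E.w X) (F.fundWeight v) = E.transport (η v) (F.fundWeight v) := by
  have hp := List.perm_insertionSort (fun x y : V × ℤ => y.2 ≤ x.2) X.toList
  refine E.mul_prod_fundWeight hη (E.reading X) H g hH hle (E.reading_isCompatible X).1 ?_ ?_ hg v
  · have : Std.Total (fun x y : V × ℤ => y.2 ≤ x.2) := ⟨fun x y => le_total _ _⟩
    have : IsTrans (V × ℤ) (fun x y : V × ℤ => y.2 ≤ x.2) := ⟨fun _ _ _ h h' => le_trans h' h⟩
    exact List.pairwise_insertionSort _ _
  · intro v p
    rw [← hX, reading, hp.mem_iff, Finset.mem_toList]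

theorem w_mem_stabilizer (X : Finset (V × ℤ)) : E.w X ∈ F.rootLatticeStabilizer := by
  refine list_prod_mem fun g hg => ?_
  obtain ⟨x, -, rfl⟩ := List.mem_map.1 hg
  exact F.s_mem_stabilizer _

/-- Every slice is reached from the slices `level T`. -/
theorem exists_slice_equiv {η : V → ℤ} (hη : E.IsSlice η) :
    ∃ g ∈ F.rootLatticeStabilizer,
      ∀ v, g (F.fundWeight v) = E.transport (η v) (F.fundWeight v) := by
  classical
  -- On the slice just below height `T` the single map `transport T` serves all the vertices; taking
  -- `T` above `η`, it remains to cross the vertices in between.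
  obtain ⟨T, hT⟩ : ∃ T, ∀ v, η v ≤ T := by
    obtain ⟨T, hT⟩ := (Set.finite_range η).bddAbove
    exact ⟨T, fun v => hT ⟨v, rfl⟩⟩
  have hle : ∀ v, η v ≤ E.level T v := by
    intro v
    by_contra! h
    have := (hη.1 v).add_le (E.isRepVertex_level T v) h
    have := E.lt_level_add T v
    have := hT v
    omega
  let X : Finset (V × ℤ) := Finset.univ.biUnion fun v =>
    ((Finset.Ioc (η v) (E.level T v)).image fun p => (v, p)).filter E.IsRepVertex
  refine ⟨E.transport T * E.w X, mul_mem (E.transport_mem_stabilizer T) (E.w_mem_stabilizer X),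
    E.mul_w_fundWeight hη (E.isSlice_level T) hle (fun v p => ?_)
      fun v => (E.transport_level T v).symm⟩
  simp only [X, Finset.mem_biUnion, Finset.mem_univ, true_and, Finset.mem_filter, Finset.mem_image,
    Finset.mem_Ioc]
  constructor
  · rintro ⟨w, ⟨q, hq, h⟩, hr⟩
    obtain ⟨rfl, rfl⟩ := Prod.mk.inj h
    exact ⟨hr, hq⟩
  · rintro ⟨hr, hq⟩
    exact ⟨v, ⟨p, hq, rfl⟩, hr⟩

end ParityFunction

end QDatum

namespace QDatum

variable {V : Type*} [Fintype V] [DecidableEq V]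

namespace Folding

variable (F : Folding V)

/-! ### Constraints on the sizes of the orbits -/

theorem exists_pow_of_orb_eq {v w : V} (h : F.orb v = F.orb w) :
    ∃ l : ℕ, l < F.d (F.orb v) ∧ (F.perm ^ l) v = w := by
  obtain ⟨l, rfl⟩ := F.exists_zpow_of_orb_eq h
  have hd : (0 : ℤ) < F.d (F.orb v) := by exact_mod_cast F.d_pos v
  have h0 := Int.emod_nonneg l hd.ne'
  have h1 := Int.emod_lt_of_pos l hd
  refine ⟨(l % F.d (F.orb v)).toNat, by omega, ?_⟩
  rw [← zpow_natCast, Int.toNat_of_nonneg h0]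
  have e : l = l % F.d (F.orb v) + F.d (F.orb v) * (l / F.d (F.orb v)) :=
    (Int.emod_add_mul_ediv _ _).symm
  conv_rhs => rw [e, zpow_add, Equiv.Perm.mul_apply,
    ParityFunction.zpow_perm_eq_self v _ (Dvd.intro _ rfl)]

theorem orb_pow (v : V) (l : ℕ) : F.orb ((F.perm ^ l) v) = F.orb v := by
  simpa using F.orb_zpow v l

theorem adj_pow (l : ℕ) {v w : V} :
    F.Δ.Adj ((F.perm ^ l) v) ((F.perm ^ l) w) ↔ F.Δ.Adj v w := by
  simpa using F.adj_zpow l (v := v) (w := w)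

theorem perm_eq_self {v : V} (h : F.d (F.orb v) = 1) : F.perm v = v := by
  simpa using ParityFunction.zpow_perm_eq_self (F := F) v 1 (by simp [h])

theorem pow_eq_self {v : V} (h : F.d (F.orb v) = 1) (l : ℕ) : (F.perm ^ l) v = v := by
  simpa using ParityFunction.zpow_perm_eq_self (F := F) v l (by simp [h])

open Classical in
theorem card_orbit (i : F.I) : (Finset.univ.filter fun v => F.orb v = i).card = F.d i := by
  rw [d, Nat.card_eq_fintype_card, Fintype.card_subtype]

/-- If all the orbits are of the same size, they have at most two elements. -/
theorem d_dvd_two_of_adj (h : ∀ v w, F.Δ.Adj v w → F.d (F.orb v) = F.d (F.orb w)) (v : V) :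
    F.d (F.orb v) ∣ 2 := by
  classical
  have hall : ∀ w, F.d (F.orb w) = F.d (F.orb v) := by
    intro w
    have := F.isADE.preconnected v w
    rw [SimpleGraph.reachable_iff_reflTransGen] at this
    induction this with
    | refl => rfl
    | tail _ h1 ih => rw [← h _ _ h1, ih]
  have hdeg : ∀ w : V, ∀ l : ℤ, (2 - ∑ u with F.Δ.Adj ((F.perm ^ l) w) u, (1 : ℤ)) =
      2 - ∑ u with F.Δ.Adj w u, (1 : ℤ) := by
    intro w l
    congr 1
    rw [Finset.sum_filter, Finset.sum_filter, ← Equiv.sum_comp (F.perm ^ l)]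
    refine Finset.sum_congr rfl fun u _ => ?_
    by_cases h : F.Δ.Adj w u
    · rw [if_pos h, if_pos ((F.adj_zpow l).2 h)]
    · rw [if_neg h, if_neg (mt (F.adj_zpow l).1 h)]
  have hsum := F.isADE.sum_two_sub_degree
  -- The summand is constant on orbits, so each orbit contributes a multiple of the common size to
  -- the total, which is `2`.
  rw [← Finset.sum_fiberwise _ F.orb] at hsum
  have : (F.d (F.orb v) : ℤ) ∣ 2 := by
    rw [← hsum]
    refine Finset.dvd_sum fun i _ => ?_
    induction i using Quotient.inductionOn with | _ w =>
    rw [Finset.sum_congr rfl (g := fun _ => 2 - ∑ u with F.Δ.Adj w u, (1 : ℤ)), Finset.sum_const,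
      nsmul_eq_mul]
    · refine Dvd.dvd.mul_right (Int.natCast_dvd_natCast.2 ?_) _
      have := F.card_orbit (F.orb w)
      rw [hall] at this
      rw [← this]
    · intro u hu
      have hu' : F.orb w = F.orb u := by simpa using (Finset.mem_filter.1 hu).2.symm
      obtain ⟨l, rfl⟩ := F.exists_zpow_of_orb_eq hu'
      exact hdeg w l
  exact_mod_cast this

/-- If a fixed vertex `v` is adjacent to an orbit with at least three elements, then this orbit has
three elements and together with `v` it is the whole diagram. -/
theorem eq_three_and_forall_adj {v w : V} (h : F.Δ.Adj v w) (hv : F.d (F.orb v) = 1)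
    (hw : 3 ≤ F.d (F.orb w)) : F.d (F.orb w) = 3 ∧ ∀ x, x = v ∨ F.Δ.Adj v x := by
  classical
  have hsub : (Finset.univ.filter fun u => F.orb u = F.orb w) ⊆
      Finset.univ.filter (F.Δ.Adj v) := by
    intro u hu
    have hu' : F.orb w = F.orb u := by simpa using (Finset.mem_filter.1 hu).2.symm
    obtain ⟨l, -, rfl⟩ := F.exists_pow_of_orb_eq hu'
    have := (F.adj_pow l).2 h
    rw [F.pow_eq_self hv] at this
    simpa using this
  have hcard := Finset.card_le_card hsub
  rw [F.card_orbit] at hcard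
  -- A vertex has at most three neighbours when it has at least three, so the orbit is the full
  -- neighbourhood of `v`. One neighbour is a leaf, hence by symmetry all are, and connectedness
  -- leaves no room for further vertices.
  obtain ⟨h3, u, hu, hleaf⟩ := F.isADE.card_neighbors v (hw.trans hcard)
  refine ⟨by omega, ?_⟩
  have heq := Finset.eq_of_subset_of_card_le hsub (by rw [F.card_orbit]; omega)
  have horb : ∀ x, F.Δ.Adj v x → F.orb u = F.orb x := by
    intro x hx
    have h1 : u ∈ Finset.univ.filter (F.Δ.Adj v) := by simpa using hu
    have h2 : x ∈ Finset.univ.filter (F.Δ.Adj v) := by simpa using hx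
    rw [← heq] at h1 h2
    exact (Finset.mem_filter.1 h1).2.trans (Finset.mem_filter.1 h2).2.symm
  intro x
  have := F.isADE.preconnected v x
  rw [SimpleGraph.reachable_iff_reflTransGen] at this
  induction this with
  | refl => exact Or.inl rfl
  | @tail y z _ hyz ih =>
    rcases ih with rfl | hy
    · exact Or.inr hyz
    · obtain ⟨l, -, rfl⟩ := F.exists_pow_of_orb_eq (horb y hy)
      obtain ⟨z, rfl⟩ := (F.perm ^ l).surjective z
      rw [F.adj_pow] at hyz
      rw [hleaf z hyz, F.pow_eq_self hv]
      exact Or.inl rfl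

end Folding

namespace ParityFunction

variable {F : Folding V} {E : ParityFunction F}

theorem d_dvd_of_zpow_eq_self (E : ParityFunction F) {v : V} {l : ℤ} (h : (F.perm ^ l) v = v) :
    (F.d (F.orb v) : ℤ) ∣ l := by
  have := (E.shift v l).dvd
  rw [h, sub_right_comm, sub_self, zero_sub, dvd_neg] at this
  exact Int.dvd_of_mul_dvd_mul_left two_ne_zero this

theorem d_dvd_r (E : ParityFunction F) (v : V) : F.d (F.orb v) ∣ F.r := by
  have := E.d_dvd_of_zpow_eq_self (v := v) (l := F.r) (by simp [Folding.r, pow_orderOf_eq_one])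
  exact_mod_cast this

theorem IsRepVertex.eq_of_orb_eq {v w : V} {p : ℤ} (hv : E.IsRepVertex (v, p))
    (hw : E.IsRepVertex (w, p)) (h : F.orb v = F.orb w) : v = w := by
  have : (⟨(v, p), hv⟩ : E.RepVertex) = ⟨(w, p), hw⟩ :=
    E.fold_bijective.1 (Subtype.ext (Prod.ext h rfl))
  exact congrArg (fun x => x.1.1) this

end ParityFunction

end QDatum

namespace QDatum

variable {V : Type*} [Fintype V] [DecidableEq V] {F : Folding V} {E : ParityFunction F}
  (Q : QDatum F E)

/-! ### Orbits and heights -/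

theorem isRepVertex_ξ (v : V) : E.IsRepVertex (v, Q.ξ v) := Q.h3 v

/-- A fixed vertex is adjacent to an orbit of another size only if the latter has size `r`, and its
heights are consecutive. -/
theorem exists_heights_of_lt {v w : V} (h : F.Δ.Adj v w) (hlt : F.d (F.orb v) < F.d (F.orb w)) :
    F.d (F.orb v) = 1 ∧ F.d (F.orb w) = F.r ∧ ∃ t, F.orb t = F.orb w ∧ |Q.ξ v - Q.ξ t| = 1 ∧
      ∀ l : ℕ, l < F.d (F.orb t) → Q.ξ ((F.perm ^ l) t) = Q.ξ t - 2 * l := by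
  obtain ⟨t, ⟨ht, h1, h2⟩, huniq⟩ :=
    Q.h2 (F.orb v) (F.orb w) ⟨v, w, rfl, rfl, h⟩ hlt v rfl
  -- Were the orbit smaller than `r`, the height condition would apply to `l = d_w`, where `σ ^ l`
  -- fixes `t`, and would give `ξ t = ξ t - 2 l`.
  have hr : F.d (F.orb w) = F.r := by
    have hr0 : 0 < F.r := orderOf_pos _
    refine le_antisymm (Nat.le_of_dvd hr0 (E.d_dvd_r w)) ?_
    by_contra! hlt'
    have := h2 _ hlt'
    have e := ParityFunction.zpow_perm_eq_self (F := F) t (F.d (F.orb w)) (by rw [ht])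
    rw [zpow_natCast] at e
    rw [e] at this
    have := F.d_pos w
    omega
  refine ⟨?_, hr, t, ht, h1, fun l hl => h2 l (by rwa [ht, hr] at hl)⟩
  obtain ⟨m, -, hm⟩ := F.exists_pow_of_orb_eq ht.symm
  have hadj := (F.adj_pow m).2 h
  rw [hm] at hadj
  -- The vertices distinguished by `v` and by `σ ^ m v` both carry the greatest height of the same
  -- orbit, so they coincide.
  have hv1 : |Q.ξ ((F.perm ^ m) v) - Q.ξ t| = 1 := by
    obtain ⟨t', ⟨ht', h1', h2'⟩, -⟩ := Q.h2 (F.orb v) (F.orb w) ⟨v, w, rfl, rfl, h⟩ hlt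
      ((F.perm ^ m) v) (F.orb_pow v m)
    obtain ⟨k, hk, rfl⟩ := F.exists_pow_of_orb_eq (ht.trans ht'.symm)
    rw [ht, hr] at hk
    have e1 := h2 k hk
    rcases Nat.eq_zero_or_pos k with rfl | hk0
    · simpa using h1'
    · have e2 := h2' (F.r - k) (by omega)
      rw [← Equiv.Perm.mul_apply, ← pow_add, Nat.sub_add_cancel hk.le, Folding.r,
        pow_orderOf_eq_one, Equiv.Perm.one_apply] at e2
      rw [← Folding.r] at e2
      omega
  have hdvd := (Q.isRepVertex_ξ ((F.perm ^ m) v)).adj_dvd (Q.isRepVertex_ξ t) hadj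
  rw [F.orb_pow, ht, min_eq_left hlt.le] at hdvd
  -- Heights of adjacent vertices differ by a multiple of the smaller orbit size; here the
  -- difference is `1`.
  have h3 : (F.d (F.orb v) : ℤ) ∣ Q.ξ ((F.perm ^ m) v) - Q.ξ t := by
    have := (Dvd.intro_left 2 rfl).trans hdvd
    simpa using this
  have h4 := (dvd_abs _ _).2 h3
  rw [hv1] at h4
  exact_mod_cast Int.eq_one_of_dvd_one (by omega) h4

end QDatum

namespace QDatum

variable {V : Type*} [Fintype V] [DecidableEq V] {F : Folding V} {E : ParityFunction F}
  (Q : QDatum F E)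

/-- If all orbits have one size, it divides `2`. Otherwise a fixed vertex is adjacent to an orbit of
size `r`, and either `r ≤ 2` or the diagram is a fixed vertex with three leaves. In the last case
the heights of the large orbit are already consecutive, so that only orbits of size two may need
raising. -/
theorem d_le_three (Q : QDatum F E) (v : V) : F.d (F.orb v) ≤ 3 ∧
    (F.d (F.orb v) = 3 → ∃ u, F.Δ.Adj u v ∧ F.d (F.orb u) < F.d (F.orb v)) := by
  by_cases h : ∀ v w, F.Δ.Adj v w → F.d (F.orb v) = F.d (F.orb w)
  · have := Nat.le_of_dvd two_pos (F.d_dvd_two_of_adj h v)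
    exact ⟨by omega, fun h => by omega⟩
  · push Not at h
    have : ∃ u w, F.Δ.Adj u w ∧ F.d (F.orb u) < F.d (F.orb w) := by
      obtain ⟨u, w, h1, h2⟩ := h
      rcases lt_or_gt_of_ne h2 with h3 | h3
      · exact ⟨u, w, h1, h3⟩
      · exact ⟨w, u, h1.symm, h3⟩
    obtain ⟨u, w, h1, h2⟩ := this
    obtain ⟨hu, hw, -⟩ := Q.exists_heights_of_lt h1 h2
    have hr0 : 0 < F.r := orderOf_pos _
    have hle := Nat.le_of_dvd hr0 (ParityFunction.d_dvd_r E v)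
    by_cases h3 : 3 ≤ F.d (F.orb w)
    · obtain ⟨h4, h5⟩ := F.eq_three_and_forall_adj h1 hu h3
      refine ⟨by omega, fun hv => ⟨u, ?_, by omega⟩⟩
      rcases h5 v with rfl | h6
      · omega
      · exact h6
    · exact ⟨by omega, fun h => by omega⟩

/-- For equal sizes the slice inequality is the height condition on an edge. Otherwise one end is
fixed and is at distance `1` from the top of the other orbit, whose heights descend from there in
steps of `2`. -/
theorem isSlice_ξ : E.IsSlice Q.ξ := by
  refine ⟨Q.isRepVertex_ξ, fun v w h => ?_⟩
  have hd := F.d_pos w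
  rcases lt_trichotomy (F.d (F.orb v)) (F.d (F.orb w)) with hlt | heq | hlt
  · obtain ⟨-, -, t, ht, h1, h2⟩ := Q.exists_heights_of_lt h hlt
    obtain ⟨l, hl, rfl⟩ := F.exists_pow_of_orb_eq ht
    rw [h2 l hl]
    rw [ht] at hl
    have := (abs_le.1 h1.le).2
    omega
  · have := Q.h1 v w h heq
    rw [heq] at this
    have := (abs_le.1 this.le).2
    omega
  · obtain ⟨-, -, t, ht, h1, h2⟩ := Q.exists_heights_of_lt h.symm hlt
    obtain ⟨l, hl, rfl⟩ := F.exists_pow_of_orb_eq ht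
    rw [h2 l hl]
    have := (abs_le.1 h1.le).1
    omega

/-! ### The top vertices of the orbits -/

theorem mem_topVertices {v : V} :
    v ∈ Q.topVertices ↔ ∀ u, F.orb u = F.orb v → Q.ξ u ≤ Q.ξ v := by
  simp [topVertices]

theorem eq_of_mem_topVertices {v w : V} (hv : v ∈ Q.topVertices) (hw : w ∈ Q.topVertices)
    (h : F.orb v = F.orb w) : v = w := by
  have h1 := Q.mem_topVertices.1 hv w h.symm
  have h2 := Q.mem_topVertices.1 hw v h
  have hrep := Q.isRepVertex_ξ w
  rw [le_antisymm h1 h2] at hrep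
  exact (Q.isRepVertex_ξ v).eq_of_orb_eq hrep h

theorem exists_top (v : V) : ∃ t ∈ Q.topVertices, F.orb t = F.orb v := by
  classical
  obtain ⟨t, ht, hmax⟩ := Finset.exists_max_image (Finset.univ.filter fun u => F.orb u = F.orb v)
    Q.ξ ⟨v, by simp⟩
  have ht' : F.orb t = F.orb v := by simpa using (Finset.mem_filter.1 ht).2
  refine ⟨t, Q.mem_topVertices.2 fun u hu => hmax u ?_, ht'⟩
  rw [Finset.mem_filter]
  exact ⟨Finset.mem_univ _, hu.trans ht'⟩

theorem pow_not_mem_topVertices {t : V} (ht : t ∈ Q.topVertices) {l : ℕ} (h0 : 0 < l)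
    (hl : l < F.d (F.orb t)) : (F.perm ^ l) t ∉ Q.topVertices := by
  intro h
  have := Q.eq_of_mem_topVertices h ht (F.orb_pow t l)
  have := ParityFunction.d_dvd_of_zpow_eq_self E (v := t) (l := l) (by simpa using this)
  have := Nat.le_of_dvd h0 (Int.natCast_dvd_natCast.1 this)
  omega

theorem mem_topVertices_of_heights {t : V}
    (h : ∀ l : ℕ, l < F.d (F.orb t) → Q.ξ ((F.perm ^ l) t) = Q.ξ t - 2 * l) :
    t ∈ Q.topVertices := by
  refine Q.mem_topVertices.2 fun u hu => ?_
  obtain ⟨l, hl, rfl⟩ := F.exists_pow_of_orb_eq hu.symm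
  rw [h l hl]
  omega

theorem mem_topVertices_of_d_eq_one {t : V} (h : F.d (F.orb t) = 1) : t ∈ Q.topVertices :=
  Q.mem_topVertices_of_heights fun l hl => by
    obtain rfl : l = 0 := by omega
    simp

/-- An orbit adjacent to an orbit of smaller size has consecutive heights. -/
theorem heights_of_adj_lt {v w t : V} (h : F.Δ.Adj v w) (hlt : F.d (F.orb v) < F.d (F.orb w))
    (ht : t ∈ Q.topVertices) (hw : F.orb t = F.orb w) (l : ℕ) (hl : l < F.d (F.orb t)) :
    Q.ξ ((F.perm ^ l) t) = Q.ξ t - 2 * l := by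
  obtain ⟨-, -, t', ht', -, h2⟩ := Q.exists_heights_of_lt h hlt
  obtain rfl := Q.eq_of_mem_topVertices ht (Q.mem_topVertices_of_heights h2) (hw.trans ht'.symm)
  exact h2 l hl

/-! ### The slice with consecutive heights in each orbit -/

open Classical in
/-- The heights of `X'` above `ξ`: each `σ(i°)` is raised to the height `ξ_{i°} - 2`. -/
noncomputable def raised (v : V) : ℤ :=
  if v ∉ Q.topVertices ∧ F.perm.symm v ∈ Q.topVertices then Q.ξ (F.perm.symm v) - 2 else Q.ξ v

/-- Raising makes the heights consecutive along each orbit: `l = 0` is untouched, `l = 1` holds by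
construction, and `l = 2` occurs only in an orbit of size three, where it held before. -/
theorem raised_pow {t : V} (ht : t ∈ Q.topVertices) {l : ℕ} (hl : l < F.d (F.orb t)) :
    Q.raised ((F.perm ^ l) t) = Q.ξ t - 2 * l := by
  have h3 := Q.d_le_three t
  obtain rfl | rfl | rfl : l = 0 ∨ l = 1 ∨ l = 2 := by omega
  · rw [raised, if_neg (by simp [ht])]
    simp
  · have := Q.pow_not_mem_topVertices ht one_pos hl
    rw [pow_one] at this ⊢
    rw [raised, if_pos ⟨this, by rwa [Equiv.symm_apply_apply]⟩, Equiv.symm_apply_apply,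
      Nat.cast_one, mul_one]
  · have h1 := Q.pow_not_mem_topVertices ht one_pos (by omega)
    rw [pow_one] at h1
    obtain ⟨u, hu, hlt⟩ := h3.2 (by omega)
    rw [raised, if_neg, Q.heights_of_adj_lt hu hlt ht rfl 2 hl]
    rintro ⟨-, h⟩
    rw [pow_two, Equiv.Perm.mul_apply, Equiv.symm_apply_apply] at h
    exact h1 h

theorem exists_top_pow (v : V) :
    ∃ t ∈ Q.topVertices, ∃ l : ℕ, l < F.d (F.orb t) ∧ (F.perm ^ l) t = v := by
  obtain ⟨t, ht, h⟩ := Q.exists_top v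
  exact ⟨t, ht, F.exists_pow_of_orb_eq h⟩

theorem raised_eq_of_adj_lt {v w : V} (h : F.Δ.Adj v w)
    (hlt : F.d (F.orb v) < F.d (F.orb w)) : Q.raised w = Q.ξ w := by
  obtain ⟨t, ht, l, hl, rfl⟩ := Q.exists_top_pow w
  rw [Q.raised_pow ht hl, Q.heights_of_adj_lt h hlt ht (F.orb_pow t l).symm l hl]

theorem raised_of_mem_topVertices {v : V} (h : v ∈ Q.topVertices) : Q.raised v = Q.ξ v :=
  if_neg fun h' => h'.1 h

theorem raised_eq_of_ne_two {v : V} (h : F.d (F.orb v) ≠ 2) : Q.raised v = Q.ξ v := by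
  have h1 := Q.d_le_three v
  have h2 := F.d_pos v
  obtain h3 | h3 : F.d (F.orb v) = 1 ∨ F.d (F.orb v) = 3 := by omega
  · exact Q.raised_of_mem_topVertices (Q.mem_topVertices_of_d_eq_one h3)
  · obtain ⟨u, hu, hlt⟩ := h1.2 h3
    exact Q.raised_eq_of_adj_lt hu hlt

theorem isRepVertex_raised (v : V) : E.IsRepVertex (v, Q.raised v) := by
  rw [raised]
  split_ifs
  · have := (E.isRepVertex_perm (F.perm.symm v) _).2 (Q.isRepVertex_ξ (F.perm.symm v))
    rwa [Equiv.apply_symm_apply] at this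
  · exact Q.isRepVertex_ξ v

/-- A height above the raised one would exceed it by at least `2 d`, and hence exceed the height of
the top of the orbit. -/
theorem le_raised (v : V) : Q.ξ v ≤ Q.raised v := by
  by_contra! h
  have h1 := (Q.isRepVertex_ξ v).add_le (Q.isRepVertex_raised v) h
  obtain ⟨t, ht, l, hl, rfl⟩ := Q.exists_top_pow v
  rw [Q.raised_pow ht hl] at h1
  have h2 := Q.mem_topVertices.1 ht _ (F.orb_pow t l)
  rw [F.orb_pow] at h1
  omega

theorem isSlice_raised : E.IsSlice Q.raised := by
  refine ⟨Q.isRepVertex_raised, fun v w h => ?_⟩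
  have hslice := Q.isSlice_ξ.2 v w h
  rcases lt_trichotomy (F.d (F.orb v)) (F.d (F.orb w)) with hlt | heq | hlt
  · rwa [Q.raised_eq_of_adj_lt h hlt, Q.raised_of_mem_topVertices
      (Q.mem_topVertices_of_d_eq_one (Q.exists_heights_of_lt h hlt).1)]
  · by_cases h2 : F.d (F.orb w) = 2
    · have hdvd := (Q.isRepVertex_raised v).adj_dvd (Q.isRepVertex_raised w) h
      rw [heq, min_self, h2] at hdvd
      obtain ⟨t, ht, l, hl, rfl⟩ := Q.exists_top_pow v
      obtain ⟨u, hu, m, hm, rfl⟩ := Q.exists_top_pow w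
      -- Rotate the edge so that its first end is the top `t` of its orbit. Then `ξ t ≤ ξ u + 2` for
      -- the other top `u`, so the raised heights differ by at most `4`; being congruent to `2`
      -- modulo `4`, the difference is less than `4`.
      obtain ⟨w, hw⟩ := (F.perm ^ l).surjective ((F.perm ^ m) u)
      have horb : F.orb w = F.orb u := by rw [← F.orb_pow w l, hw, F.orb_pow]
      have hadj := h
      rw [← hw, F.adj_pow] at hadj
      rw [F.orb_pow, F.orb_pow] at heq
      rw [F.orb_pow] at h2
      have h3 := Q.h1 t w hadj (heq.trans (by rw [horb]))
      have h4 := (abs_le.1 h3.le).2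
      have h5 := Q.mem_topVertices.1 hu w horb
      rw [Q.raised_pow ht hl, Q.raised_pow hu hm] at *
      rw [F.orb_pow]
      omega
    · rwa [Q.raised_eq_of_ne_two h2, Q.raised_eq_of_ne_two (by rwa [heq])]
  · rwa [Q.raised_eq_of_adj_lt h.symm hlt, Q.raised_of_mem_topVertices
      (Q.mem_topVertices_of_d_eq_one (Q.exists_heights_of_lt h.symm hlt).1)]

theorem mem_Xprime {v : V} {p : ℤ} :
    (v, p) ∈ Q.Xprime ↔ E.IsRepVertex (v, p) ∧ Q.ξ v < p ∧ p ≤ Q.raised v := by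
  simp only [Xprime, Finset.mem_biUnion, Finset.mem_filter, Finset.mem_image, Finset.mem_Ioc,
    Prod.mk.injEq]
  constructor
  · rintro ⟨t, ht, ⟨q, ⟨h1, h2⟩, rfl, rfl⟩, hr⟩
    refine ⟨hr, h1, ?_⟩
    have hd : 1 < F.d (F.orb t) := by
      by_contra! hle
      have h3 := F.perm_eq_self (v := t) (by have := F.d_pos t; omega)
      change F.σ t = t at h3
      rw [h3] at h1
      omega
    have := Q.raised_pow ht hd
    rw [pow_one] at this
    change Q.raised (F.σ t) = _ at this
    rw [this]
    simpa using h2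
  · rintro ⟨hr, h1, h2⟩
    rw [raised] at h2
    split_ifs at h2 with h
    · have e : F.σ (F.perm.symm v) = v := F.perm.apply_symm_apply v
      exact ⟨F.perm.symm v, h.2, ⟨p, ⟨by rwa [e], h2⟩, e, rfl⟩, hr⟩
    · omega

/-- Translation by `σ` preserves the raised slice except at the top of each orbit, which falls by
one period `2 d`. This is why `X°` has exactly one vertex for each orbit. -/
theorem raised_perm {t : V} (ht : t ∈ Q.topVertices) {l : ℕ} (hl : l < F.d (F.orb t)) :
    Q.raised (F.perm.symm ((F.perm ^ l) t)) - 2 =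
      if l = 0 then Q.ξ t - 2 * F.d (F.orb t) else Q.raised ((F.perm ^ l) t) := by
  split_ifs with h
  · subst h
    have h1 := Q.raised_pow ht (l := F.d (F.orb t) - 1) (by omega)
    have e : F.perm.symm ((F.perm ^ 0) t) = (F.perm ^ (F.d (F.orb t) - 1)) t := by
      rw [Equiv.symm_apply_eq, ← Equiv.Perm.mul_apply, ← pow_succ', Nat.sub_add_cancel (by omega)]
      have := ParityFunction.zpow_perm_eq_self (F := F) t (F.d (F.orb t)) dvd_rfl
      rw [zpow_natCast] at this
      rw [this, pow_zero, Equiv.Perm.one_apply]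
    rw [e, h1]
    omega
  · obtain ⟨l, rfl⟩ := Nat.exists_eq_succ_of_ne_zero h
    rw [Q.raised_pow ht hl, Nat.succ_eq_add_one, pow_succ', Equiv.Perm.mul_apply,
      Equiv.symm_apply_apply, Q.raised_pow ht (by omega)]
    push_cast
    ring

/-- The slice `raised`, translated by `σ`. -/
noncomputable def lowered (v : V) : ℤ := Q.raised (F.perm.symm v) - 2

theorem lowered_perm (v : V) : Q.lowered (F.perm v) = Q.raised v - 2 := by
  rw [lowered, Equiv.symm_apply_apply]

theorem isSlice_lowered : E.IsSlice Q.lowered := by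
  constructor
  · intro v
    obtain ⟨v, rfl⟩ := F.perm.surjective v
    rw [lowered_perm]
    exact (E.isRepVertex_perm v _).2 (Q.isRepVertex_raised v)
  · intro v w h
    obtain ⟨v, rfl⟩ := F.perm.surjective v
    obtain ⟨w, rfl⟩ := F.perm.surjective w
    rw [lowered_perm, lowered_perm, F.orb_perm]
    have := Q.isSlice_raised.2 v w (F.adj_perm.1 h)
    omega

theorem lowered_le (v : V) : Q.lowered v ≤ Q.raised v := by
  obtain ⟨t, ht, l, hl, rfl⟩ := Q.exists_top_pow v
  rw [lowered, Q.raised_perm ht hl]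
  split_ifs with h
  · subst h
    rw [Q.raised_pow ht hl]
    omega
  · exact le_rfl

theorem mem_Xcirc {v : V} {p : ℤ} :
    (v, p) ∈ Q.Xcirc ↔ E.IsRepVertex (v, p) ∧ Q.lowered v < p ∧ p ≤ Q.raised v := by
  simp only [Xcirc, Finset.mem_image, Prod.mk.injEq]
  constructor
  · rintro ⟨t, ht, rfl, rfl⟩
    have hd := F.d_pos t
    have := Q.raised_perm ht (l := 0) hd
    rw [if_pos rfl, pow_zero, Equiv.Perm.one_apply] at this
    refine ⟨Q.isRepVertex_ξ t, ?_, (Q.raised_of_mem_topVertices ht).ge⟩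
    rw [lowered, this]
    omega
  · rintro ⟨hr, h1, h2⟩
    obtain ⟨t, ht, l, hl, rfl⟩ := Q.exists_top_pow v
    rw [lowered, Q.raised_perm ht hl] at h1
    split_ifs at h1 with h
    · subst h
      rw [pow_zero, Equiv.Perm.one_apply] at *
      refine ⟨t, ht, rfl, ?_⟩
      rw [Q.raised_of_mem_topVertices ht] at h2
      by_contra hne
      have := (Q.isRepVertex_ξ t).add_le hr (lt_of_le_of_ne h2 (Ne.symm hne))
      omega
    · omega

/-- Crossing `X°` from the raised slice ends on its `σ`-translate, so the equivariance of
`transport` gives `g τ° = coxeter g` for the `g` of the raised slice. Crossing `X'` continues from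
there to `ξ` and conjugates `τ°` into `τ`. -/
theorem exists_conj_coxeter : ∃ g ∈ F.rootLatticeStabilizer, g * Q.tau = E.coxeter * g ∧
    ∀ v, g (F.fundWeight v) = E.transport (Q.ξ v) (F.fundWeight v) := by
  obtain ⟨g, hg, hgv⟩ := E.exists_slice_equiv Q.isSlice_raised
  refine ⟨g * E.w Q.Xprime, mul_mem hg (E.w_mem_stabilizer _), ?_,
    E.mul_w_fundWeight Q.isSlice_ξ Q.isSlice_raised Q.le_raised (fun v p => Q.mem_Xprime) hgv⟩
  have key : g * Q.tauCirc = E.coxeter * g := by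
    refine F.linearEquiv_ext fun v => ?_
    have h1 := E.mul_w_fundWeight Q.isSlice_lowered Q.isSlice_raised Q.lowered_le
      (fun v p => Q.mem_Xcirc) hgv (F.perm v)
    rw [tauCirc, ← mul_assoc, LinearEquiv.mul_apply, F.sigmaWeight_fundWeight, h1, lowered_perm,
      LinearEquiv.mul_apply, hgv, ← LinearEquiv.mul_apply, E.coxeter_mul_transport,
      LinearEquiv.mul_apply, F.sigmaWeight_fundWeight]
  rw [tau, ← mul_assoc E.coxeter, ← key]
  group

end QDatum

namespace QDatum

variable {V : Type*} [Fintype V] [DecidableEq V] {F : Folding V} {E : ParityFunction F}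
  (Q : QDatum F E)

/-! ### The `𝒬`-weights of the variables -/

/-- The sign `(-1)^k` absorbs the case distinction in the recursion for `φ`: in both cases the
signed root is just moved by a power of `τ`, and the positivity of roots plays no role. -/
theorem signedRoot_stepUp (v : V) (x : F.Weight × ℤ) :
    signedRoot (Q.stepUp v x) = (Q.tau ^ (-(F.d (F.orb v) : ℤ))) (signedRoot x) := by
  rw [stepUp, signedRoot, signedRoot, map_zsmul]
  split_ifs
  · rfl
  · simp [Int.negOnePow_succ]

theorem signedRoot_stepDown (v : V) (x : F.Weight × ℤ) :
    signedRoot (Q.stepDown v x) = (Q.tau ^ (F.d (F.orb v) : ℤ)) (signedRoot x) := by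
  rw [stepDown, signedRoot, signedRoot, map_zsmul]
  split_ifs
  · rfl
  · simp [Int.negOnePow_sub]

theorem signedRoot_iterate {f : F.Weight × ℤ → F.Weight × ℤ} {g : F.Weight ≃ₗ[ℤ] F.Weight}
    (h : ∀ x, signedRoot (f x) = g (signedRoot x)) (n : ℕ) (x : F.Weight × ℤ) :
    signedRoot (f^[n] x) = (g ^ n) (signedRoot x) := by
  induction n with
  | zero => simp
  | succ n ih => rw [Function.iterate_succ_apply', h, ih, pow_succ', LinearEquiv.mul_apply]

theorem signedRoot_phi {v : V} {p : ℤ} (h : E.IsRepVertex (v, p)) :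
    signedRoot (Q.phi ⟨(v, p), h⟩) =
      (Q.tau ^ (-(F.d (F.orb v) * ((p - Q.ξ v) / (2 * F.d (F.orb v)))))) (Q.gamma v) := by
  have h0 : signedRoot (Q.gamma v, 0) = Q.gamma v := by simp [signedRoot]
  rw [phi]
  dsimp only
  generalize (p - Q.ξ v) / (2 * F.d (F.orb v)) = n
  split_ifs with hn
  · rw [signedRoot_iterate (Q.signedRoot_stepUp v), h0, ← zpow_natCast, ← zpow_mul,
      Int.toNat_of_nonneg hn, neg_mul]
  · rw [signedRoot_iterate (Q.signedRoot_stepDown v), h0, ← zpow_natCast, ← zpow_mul,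
      Int.toNat_of_nonneg (by omega), mul_neg]

theorem coxeter_zpow_transport_fundWeight (v : V) (p n : ℤ) :
    (E.coxeter ^ (F.d (F.orb v) * n)) (E.transport p (F.fundWeight v)) =
      E.transport (p - 2 * F.d (F.orb v) * n) (F.fundWeight v) := by
  rw [← LinearEquiv.mul_apply, E.coxeter_zpow_mul_transport, LinearEquiv.mul_apply,
    F.sigmaWeight_zpow_fundWeight, ParityFunction.zpow_perm_eq_self v _ (Dvd.intro _ rfl),
    mul_assoc]

/-- Under `g`, the vector `γ_v` is the change of the transported `ϖ_v` over one full period below `ξ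
v`, and powers of `coxeter` shift this period to `p`. All the change takes place in the first step
of the period. -/
theorem map_signedRoot_phi {g : F.Weight ≃ₗ[ℤ] F.Weight} (hg : g * Q.tau = E.coxeter * g)
    (hgv : ∀ v, g (F.fundWeight v) = E.transport (Q.ξ v) (F.fundWeight v))
    {v : V} {p : ℤ} (h : E.IsRepVertex (v, p)) :
    g (signedRoot (Q.phi ⟨(v, p), h⟩)) =
      E.transport p (F.fundWeight v) - E.transport (p - 1) (F.fundWeight v) := by
  have hz : ∀ (n : ℤ) (x : F.Weight), g ((Q.tau ^ n) x) = (E.coxeter ^ n) (g x) := by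
    intro n x
    have : E.coxeter = g * Q.tau * g⁻¹ := by rw [hg, mul_inv_cancel_right]
    rw [← LinearEquiv.mul_apply, ← LinearEquiv.mul_apply, this, conj_zpow,
      inv_mul_cancel_right]
  have hγ : g (Q.gamma v) = E.transport (Q.ξ v) (F.fundWeight v) -
      E.transport (Q.ξ v - 2 * F.d (F.orb v)) (F.fundWeight v) := by
    have h1 := hz (F.d (F.orb v)) (F.fundWeight v)
    have h2 := coxeter_zpow_transport_fundWeight (E := E) v (Q.ξ v) 1
    rw [mul_one, mul_one] at h2
    rw [zpow_natCast, hgv, h2] at h1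
    rw [gamma, map_sub, h1, hgv]
  obtain ⟨n, hn⟩ := h.dvd_sub (Q.isRepVertex_ξ v)
  have hd := F.d_pos v
  rw [Q.signedRoot_phi h, hz, hγ, hn, Int.mul_ediv_cancel_left _ (by omega), map_sub, ← mul_neg,
    coxeter_zpow_transport_fundWeight, coxeter_zpow_transport_fundWeight,
    ← E.transport_sub_fundWeight h]
  have e1 : Q.ξ v - 2 * F.d (F.orb v) * -n = p := by linarith
  have e2 : Q.ξ v - 2 * F.d (F.orb v) - 2 * F.d (F.orb v) * -n = p - 2 * F.d (F.orb v) := by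
    linarith
  rw [e1, e2]

theorem wt_single (x : E.Ihat) (u : ℤ) :
    Q.wt (Finsupp.single x u) = u • signedRoot (Q.phiBar x) := by
  simp [wt]

namespace ParityFunction

variable (E) in
/-- A homomorphism on Laurent monomials sends each variable `Y_{i,p}` to the corresponding difference
of two transported fundamental weights. -/
def IsTransportHom (Φ : E.Monomial →+ F.Weight) : Prop :=
  ∀ v p, E.IsRepVertex (v, p) → Φ (E.Y (F.orb v) p) =
    E.transport p (F.fundWeight v) - E.transport (p - 1) (F.fundWeight v)

theorem IsRepVertex.memIhat {v : V} {p : ℤ} (h : E.IsRepVertex (v, p)) :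
    E.MemIhat (F.orb v) p := (E.fold ⟨(v, p), h⟩).2

theorem MemIhat.exists_isRepVertex {i : F.I} {p : ℤ} (h : E.MemIhat i p) :
    ∃ v, F.orb v = i ∧ E.IsRepVertex (v, p) := by
  obtain ⟨⟨⟨v, q⟩, hv⟩, he⟩ := E.fold_bijective.2 ⟨(i, p), h⟩
  obtain ⟨h1, h2⟩ := Prod.mk.inj (congrArg Subtype.val he)
  dsimp only at h1 h2
  subst h2
  exact ⟨v, h1, hv⟩

end ParityFunction

/-- After composition with `g` the values of the weight on the variables no longer involve the
Q-datum, only the transport. -/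
theorem exists_isTransportHom : ∃ g ∈ F.rootLatticeStabilizer,
    E.IsTransportHom ((g.toLinearMap.toAddMonoidHom).comp Q.wt) := by
  obtain ⟨g, hg, h1, h2⟩ := Q.exists_conj_coxeter
  refine ⟨g, hg, fun v p h => ?_⟩
  rw [← Q.map_signedRoot_phi h1 h2 h, AddMonoidHom.comp_apply, ParityFunction.Y, dif_pos h.memIhat,
    wt_single, one_smul, phiBar]
  have : E.unfold ⟨(F.orb v, p), h.memIhat⟩ = ⟨(v, p), h⟩ := by
    rw [ParityFunction.unfold, Equiv.symm_apply_eq]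
    rfl
  rw [this]
  rfl

/-! ### The `𝒬`-weight of `A_{i,p}` -/

/-- An edge from `v` to `σ ^ l v` forces `d ≡ 2 l` modulo `2 d`, by the edge and shift congruences.
With `d ≤ 3` and `l < d` only `d = 2`, `l = 1` remains, which is excluded for a folding. -/
theorem orb_ne_of_adj (Q : QDatum F E) {v w : V} (h : F.Δ.Adj v w) : F.orb v ≠ F.orb w := by
  intro heq
  obtain ⟨l, hl, rfl⟩ := F.exists_pow_of_orb_eq heq
  have h1 := (E.adj _ _ h).dvd
  have h2 := (E.shift v l).dvd
  rw [F.orb_pow, min_self] at h1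
  rw [zpow_natCast] at h2
  have h3 := dvd_add h1 h2
  have e : ∀ a b d : ℤ, b + d - a + (a - 2 * l - b) = d - 2 * l := by intros; ring
  rw [e] at h3
  have hd := (Q.d_le_three v).1
  have : F.d (F.orb v) = 2 ∧ l = 1 := by
    generalize F.d (F.orb v) = d at *
    obtain rfl | rfl | rfl | rfl : d = 0 ∨ d = 1 ∨ d = 2 ∨ d = 3 := by omega
    all_goals omega
  rw [this.2, pow_one] at h
  exact F.not_adj v h

namespace Folding

variable (F)

theorem c_eq_of_le {i j : F.I} (hij : j ≠ i) (h : F.orbAdj j i)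
    (hle : F.d i ≤ F.d j) : F.c j i = -1 := by
  rw [Folding.c, if_neg hij, if_pos h]
  congr 1
  have hi := F.d_pos' i
  have hj := F.d_pos' j
  rw [Int.ceil_eq_iff]
  constructor
  · push_cast
    rw [sub_self]
    positivity
  · push_cast
    rw [div_le_one (by exact_mod_cast hj)]
    exact_mod_cast hle

theorem c_eq_of_d_eq_one {i j : F.I} (hij : j ≠ i) (h : F.orbAdj j i)
    (hj : F.d j = 1) : F.c j i = -F.d i := by
  rw [Folding.c, if_neg hij, if_pos h, hj]
  simp

/-- Ensures that the shifts by `1` and `2` in `A_{i,p}` stay strictly between `p - d_i` and `p +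
d_i`. -/
theorem lt_of_c_eq_neg {i j : F.I} {n : ℕ} (hn : 1 ≤ n)
    (h : F.c j i = -(n + 1 : ℤ)) : n < F.d i := by
  rw [Folding.c] at h
  split_ifs at h
  · omega
  · have h1 : ⌈(F.d i : ℚ) / F.d j⌉ = n + 1 := by omega
    rw [Int.ceil_eq_iff] at h1
    have hj : (1 : ℚ) ≤ F.d j := by exact_mod_cast F.d_pos' j
    have h2 : (F.d i : ℚ) / F.d j ≤ F.d i := div_le_self (by positivity) hj
    have h3 : (n : ℚ) < F.d i := by
      have := h1.1
      push_cast at this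
      linarith
    exact_mod_cast h3
  · omega

end Folding

namespace ParityFunction

theorem transport_eq_of_forall_not {v : V} {p q : ℤ} (hpq : p ≤ q)
    (h : ∀ k, p < k → k ≤ q → ¬ E.IsRepVertex (v, k)) :
    E.transport q (F.fundWeight v) = E.transport p (F.fundWeight v) := by
  have h1 := E.isRepVertex_level q v
  have h2 := E.level_le q v
  have h3 : E.level q v ≤ p := by
    by_contra! h'
    exact h _ h' h2 h1
  have h4 := E.lt_level_add q v
  rw [E.transport_fundWeight_eq h1 h2 h4, E.transport_fundWeight_eq h1 h3 (by omega)]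

/-- The contribution of the orbit `j` to the weight of `A_{i,p}`, where `v` belongs to `i`. -/
theorem IsTransportHom.sum_orbit (Q : QDatum F E) {Φ : E.Monomial →+ F.Weight}
    (hΦ : E.IsTransportHom Φ) {v : V} {p : ℤ}
    (hv : E.IsRepVertex (v, p + F.d (F.orb v))) (j : F.I) [DecidablePred (F.Δ.Adj v)]
    [DecidableEq F.I] :
    ∑ w ∈ Finset.univ.filter (F.Δ.Adj v) with F.orb w = j,
      (E.transport (p + F.d (F.orb v)) (F.fundWeight w) -
        E.transport (p - F.d (F.orb v)) (F.fundWeight w)) =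
    (if F.c j (F.orb v) = -1 then Φ (E.Y j p) else 0) +
      (if F.c j (F.orb v) = -2 then Φ (E.Y j (p - 1) + E.Y j (p + 1)) else 0) +
      (if F.c j (F.orb v) = -3 then Φ (E.Y j (p - 2) + E.Y j p + E.Y j (p + 2)) else 0) := by
  have hd := F.d_pos v
  by_cases hadj : ∃ w, F.Δ.Adj v w ∧ F.orb w = j
  swap
  · rw [Finset.sum_eq_zero]
    · have hc : F.c j (F.orb v) = 2 ∨ F.c j (F.orb v) = 0 := by
        by_cases hj : j = F.orb v
        · exact Or.inl (if_pos hj)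
        · refine Or.inr ?_
          rw [Folding.c, if_neg hj, if_neg]
          rintro ⟨a, b, ha, hb, hab⟩
          obtain ⟨l, -, rfl⟩ := F.exists_pow_of_orb_eq hb
          exact hadj ⟨(F.perm ^ l) a, ((F.adj_pow l).2 hab).symm, (F.orb_pow a l).trans ha⟩
      rcases hc with hc | hc <;> simp [hc]
    · intro w hw
      simp only [Finset.mem_filter, Finset.mem_univ, true_and] at hw
      exact absurd ⟨w, hw⟩ hadj
  obtain ⟨w, hw, rfl⟩ := hadj
  have hne : F.orb w ≠ F.orb v := (Q.orb_ne_of_adj hw).symm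
  have hor : F.orbAdj (F.orb w) (F.orb v) := ⟨w, v, rfl, rfl, hw.symm⟩
  rcases le_or_gt (F.d (F.orb v)) (F.d (F.orb w)) with hle | hlt
  · have hc := F.c_eq_of_le hne hor hle
    -- Heights over these neighbours are congruent to `p` modulo `2 d_v`, so the window from `p -
    -- d_v` (excluded) to `p + d_v` can contain only `p` itself. In the orbit just one vertex `u`
    -- has height `p`, and only its weight changes.
    have hrep : ∀ u k, F.Δ.Adj v u → F.orb u = F.orb w → E.IsRepVertex (u, k) →
        (2 * F.d (F.orb v) : ℤ) ∣ p - k := by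
      intro u k hu huw hk
      have := hv.adj_dvd hk hu
      rw [huw, min_eq_left hle] at this
      rwa [show p + F.d (F.orb v) - k - F.d (F.orb v) = p - k by ring] at this
    obtain ⟨u, huw, hu, hup⟩ : ∃ u, F.orb u = F.orb w ∧ F.Δ.Adj v u ∧ E.IsRepVertex (u, p) := by
      rcases hle.eq_or_lt with heq | hlt
      · refine ⟨w, rfl, hw, (Q.isRepVertex_ξ w).of_dvd_sub ?_⟩
        have := hrep w _ hw rfl (Q.isRepVertex_ξ w)
        rwa [heq, ← dvd_neg, neg_sub] at this
      · have h1 := (Q.exists_heights_of_lt hw hlt).1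
        have hpar := hrep w _ hw rfl (Q.isRepVertex_ξ w)
        have hmem : E.MemIhat (F.orb w) p := by
          have h2 : (2 : ℤ) ∣ Q.ξ w - E.epsOrb (F.orb w) := (Q.isRepVertex_ξ w).memIhat
          have h3 : (2 : ℤ) ∣ p - Q.ξ w := (Dvd.intro _ rfl).trans hpar
          change (2 : ℤ) ∣ p - E.epsOrb (F.orb w)
          omega
        obtain ⟨u, hu, hup⟩ := hmem.exists_isRepVertex
        obtain ⟨l, -, rfl⟩ := F.exists_pow_of_orb_eq hu.symm
        refine ⟨_, hu, ?_, hup⟩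
        have := (F.adj_pow l).2 hw
        rwa [F.pow_eq_self h1] at this
    rw [if_pos hc, if_neg (by omega), if_neg (by omega), add_zero, add_zero,
      Finset.sum_eq_single u, ← huw, hΦ u p hup]
    · have hdu : F.d (F.orb v) ≤ F.d (F.orb u) := by rwa [huw]
      rw [E.transport_fundWeight_eq hup (p := p + F.d (F.orb v)) (by omega) (by omega),
        ← E.transport_sub_fundWeight hup,
        E.transport_fundWeight_eq (p := p - F.d (F.orb v))
          (hup.of_dvd_sub (q := p - 2 * F.d (F.orb u)) (by simp)) (by omega) (by omega)]
    · intro x hx hxu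
      simp only [Finset.mem_filter, Finset.mem_univ, true_and] at hx
      rw [sub_eq_zero]
      refine transport_eq_of_forall_not (by omega) fun k h1 h2 hk => hxu ?_
      have h3 := hrep x k hx.1 hx.2 hk
      have h4 : k = p := by
        obtain ⟨n, hn⟩ := h3
        have h5 : n < 1 := by nlinarith
        have h6 : -1 < n := by nlinarith
        obtain rfl : n = 0 := by omega
        rw [mul_zero] at hn
        omega
      subst h4
      exact hk.eq_of_orb_eq hup (hx.2.trans huw.symm)
    · intro hu'
      simp [hu, huw] at hu'
  · have h1 := (Q.exists_heights_of_lt hw.symm hlt).1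
    have hc := F.c_eq_of_d_eq_one hne hor h1
    have hd3 := (Q.d_le_three v).1
    rw [Finset.sum_eq_single w]
    rotate_left
    · intro x hx hxw
      simp only [Finset.mem_filter, Finset.mem_univ, true_and] at hx
      obtain ⟨l, -, rfl⟩ := F.exists_pow_of_orb_eq hx.2.symm
      exact absurd (F.pow_eq_self h1 l) hxw
    · intro hw'
      simp [hw] at hw'
    have hdvd := hv.adj_dvd (Q.isRepVertex_ξ w) hw
    rw [min_eq_right hlt.le, h1] at hdvd
    -- Here `w` is fixed, hence the only neighbour in its orbit. Every second height over `w` is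
    -- occupied, so the window of length `2 d_v` contains two or three steps according to `d_v`.
    have hrep : ∀ k, E.IsRepVertex (w, k) ↔ (2 : ℤ) ∣ p + F.d (F.orb v) - 1 - k := by
      intro k
      have h2 : (2 : ℤ) ∣ Q.ξ w - E.ε w := by
        have : (2 * F.d (F.orb w) : ℤ) ∣ Q.ξ w - E.ε w := Q.isRepVertex_ξ w
        rwa [h1] at this
      rw [isRepVertex_iff, h1]
      push_cast at hdvd ⊢
      omega
    have hstep : ∀ k, (2 : ℤ) ∣ p + F.d (F.orb v) - 1 - k → Φ (E.Y (F.orb w) k) =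
        E.transport k (F.fundWeight w) - E.transport (k - 1) (F.fundWeight w) :=
      fun k hk => hΦ w k ((hrep k).2 hk)
    have hstay : ∀ k, ¬ (2 : ℤ) ∣ p + F.d (F.orb v) - 1 - k →
        E.transport k (F.fundWeight w) = E.transport (k - 1) (F.fundWeight w) := by
      intro k hk
      rw [E.transport_sub_one, LinearEquiv.mul_apply,
        E.layer_fundWeight_of_not_mem (mt (hrep k).1 hk)]
    rw [h1] at hlt
    obtain h2 | h3 : F.d (F.orb v) = 2 ∨ F.d (F.orb v) = 3 := by omega
    · rw [h2] at hc hstep hstay ⊢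
      rw [if_neg (by omega), if_pos (by simpa using hc), if_neg (by omega), map_add,
        hstep (p - 1) (by push_cast; omega), hstep (p + 1) (by push_cast; omega)]
      have e1 := hstay (p + 2) (by push_cast; omega)
      have e2 := hstay p (by push_cast; omega)
      rw [show p + 2 - 1 = p + 1 by ring] at e1
      rw [show p + 1 - 1 = p by ring, show p - 1 - 1 = p - 2 by ring]
      push_cast
      rw [e1, e2]
      abel
    · rw [h3] at hc hstep hstay ⊢
      rw [if_neg (by omega), if_neg (by omega), if_pos (by simpa using hc), map_add, map_add,
        hstep (p - 2) (by push_cast; omega), hstep p (by push_cast; omega),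
        hstep (p + 2) (by push_cast; omega)]
      have e1 := hstay (p + 3) (by push_cast; omega)
      have e2 := hstay (p + 1) (by push_cast; omega)
      have e3 := hstay (p - 1) (by push_cast; omega)
      rw [show p + 3 - 1 = p + 2 by ring] at e1
      rw [show p + 1 - 1 = p by ring] at e2
      rw [show p - 1 - 1 = p - 2 by ring] at e3
      rw [show p + 2 - 1 = p + 1 by ring, show p - 2 - 1 = p - 3 by ring]
      push_cast
      rw [e1, e2, e3]
      abel

/-- Subtract the additivity relations at heights `p + d` and `p - d`. As `ϖ_v` does not move between
`p + d - 1` and `p - d`, the terms at `v` reduce to the two outer variables, and the neighbour sums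
are computed orbit by orbit. -/
theorem IsTransportHom.map_A (Q : QDatum F E) {Φ : E.Monomial →+ F.Weight}
    (hΦ : E.IsTransportHom Φ) {i : F.I} {p : ℤ} (h : E.MemIhat i (p - F.d i)) :
    Φ (E.A i p) = 0 := by
  classical
  obtain ⟨v, rfl, hv⟩ := h.exists_isRepVertex
  have hv' : E.IsRepVertex (v, p + F.d (F.orb v)) :=
    hv.of_dvd_sub ⟨-1, by ring⟩
  have h1 := E.transport_add_transport_sub_one hv'
  have h2 := E.transport_add_transport_sub_one hv
  have h3 := E.transport_sub_fundWeight hv'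
  rw [show p + F.d (F.orb v) - 2 * F.d (F.orb v) = p - F.d (F.orb v) by ring] at h3
  have hY : Φ (E.Y (F.orb v) (p - F.d (F.orb v))) + Φ (E.Y (F.orb v) (p + F.d (F.orb v))) =
      ∑ w with F.Δ.Adj v w, (E.transport (p + F.d (F.orb v)) (F.fundWeight w) -
        E.transport (p - F.d (F.orb v)) (F.fundWeight w)) := by
    rw [hΦ v _ hv, hΦ v _ hv', Finset.sum_sub_distrib, ← h1, ← h2, ← h3]
    abel
  rw [← Finset.sum_fiberwise _ F.orb,
    Finset.sum_congr rfl fun j _ => hΦ.sum_orbit Q hv' j,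
    Finset.sum_add_distrib, Finset.sum_add_distrib] at hY
  rw [A, map_sub, map_sub, map_sub, map_add, hY, map_sum, map_sum, map_sum, Finset.sum_filter,
    Finset.sum_filter, Finset.sum_filter]
  abel

end ParityFunction

theorem wt_A {i : F.I} {p : ℤ} (h : E.MemIhat i (p - F.d i)) : Q.wt (E.A i p) = 0 := by
  obtain ⟨g, -, hg⟩ := Q.exists_isTransportHom
  have := hg.map_A Q h
  exact (LinearEquiv.map_eq_zero_iff g).1 this

end QDatum

namespace QDatum

variable {V : Type*} [Fintype V] [DecidableEq V] {F : Folding V} {E : ParityFunction F}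
  (Q : QDatum F E)

/-! ### The simple roots as a basis of the root lattice -/

namespace Folding

variable (F : Folding V)

/-- The linear map that sends the basis vectors to the simple roots. -/
noncomputable def rootCombination : (V → ℤ) →ₗ[ℤ] F.Weight :=
  Fintype.linearCombination ℤ F.simpleRoot

theorem rootCombination_injective : Function.Injective F.rootCombination := by
  classical
  rw [injective_iff_map_eq_zero]
  intro x hx
  refine F.isADE.eq_zero_of_two_mul_eq_sum x fun v => ?_
  have := congrFun hx v
  rw [rootCombination, Fintype.linearCombination_apply, Finset.sum_apply] at this
  simp only [Pi.smul_apply, F.simpleRoot_apply, smul_eq_mul, mul_sub, Finset.sum_sub_distrib,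
    Pi.zero_apply, mul_ite, mul_zero, mul_one, Finset.sum_ite_eq, Finset.mem_univ, if_true] at this
  rw [Finset.sum_filter]
  simp only [F.Δ.adj_comm v]
  linarith

theorem mem_rootLattice_iff {x : F.Weight} :
    x ∈ F.rootLattice ↔ ∃ a : V → ℤ, F.rootCombination a = x := by
  constructor
  · intro hx
    have : F.rootLattice ≤ F.rootCombination.toAddMonoidHom.range := by
      rw [rootLattice, AddSubgroup.closure_le]
      rintro _ ⟨v, rfl⟩
      exact ⟨Pi.single v 1, by simp [rootCombination, Fintype.linearCombination_apply_single]⟩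
    exact this hx
  · rintro ⟨a, rfl⟩
    rw [rootCombination, Fintype.linearCombination_apply]
    exact sum_mem fun v _ => zsmul_mem (F.simpleRoot_mem_rootLattice v) _

/-- A generating family of the root lattice with as many members as simple roots is linearly
independent. -/
theorem eq_zero_of_sum_eq_zero {y : V → F.Weight} (hy : ∀ v, y v ∈ F.rootLattice)
    (hgen : F.rootLattice ≤ AddSubgroup.closure (Set.range y)) {a : V → ℤ}
    (ha : ∑ v, a v • y v = 0) : a = 0 := by
  let R : Submodule ℤ F.Weight := AddSubgroup.toIntSubmodule F.rootLattice
  have hi : ∀ a, F.rootCombination a ∈ R := fun a => F.mem_rootLattice_iff.2 ⟨a, rfl⟩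
  have hf : ∀ a, Fintype.linearCombination ℤ y a ∈ R := fun a => by
    rw [Fintype.linearCombination_apply]
    exact R.sum_mem fun v _ => R.smul_mem _ (hy v)
  have hinj : Function.Injective (F.rootCombination.codRestrict R hi) :=
    fun a b h => F.rootCombination_injective (congrArg Subtype.val h)
  have hsurj : Function.Surjective ((Fintype.linearCombination ℤ y).codRestrict R hf) := by
    rintro ⟨x, hx⟩
    have hle : AddSubgroup.closure (Set.range y) ≤
        (Fintype.linearCombination ℤ y).toAddMonoidHom.range := by
      rw [AddSubgroup.closure_le]
      rintro _ ⟨v, rfl⟩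
      exact ⟨Pi.single v 1, by simp [Fintype.linearCombination_apply_single]⟩
    obtain ⟨a, ha⟩ := hle (hgen hx)
    exact ⟨a, Subtype.ext ha⟩
  have hR : Module.Finite ℤ R := Module.Finite.of_surjective
    (F.rootCombination.codRestrict R hi) (by
      rintro ⟨x, hx⟩
      obtain ⟨a, ha⟩ := F.mem_rootLattice_iff.1 hx
      exact ⟨a, Subtype.ext ha⟩)
  -- By nondegeneracy of the Cartan matrix `ℤ^V` embeds in the root lattice, which is finitely
  -- generated; Orzech's property then makes any surjection from `ℤ^V` onto it injective.
  have hfin := OrzechProperty.injective_of_surjective_of_injective _ _ hinj hsurj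
  refine hfin (Subtype.ext ?_)
  simpa [Fintype.linearCombination_apply] using ha

end Folding

/-! ### Generators of `ℳ/ℳ_A` -/

namespace ParityFunction

/-- The variables indexed by the slice `level 0`. -/
noncomputable def sliceVar (E : ParityFunction F) (v : V) : E.Monomial :=
  E.Y (F.orb v) (E.level 0 v)

/-- The subgroup generated by `ℳ_A` and the variables indexed by a slice. -/
noncomputable def sliceSpan (E : ParityFunction F) : AddSubgroup E.Monomial :=
  E.subgroupA ⊔ AddSubgroup.closure (Set.range E.sliceVar)

theorem Y_of_not_memIhat {i : F.I} {p : ℤ} (h : ¬ E.MemIhat i p) : E.Y i p = 0 := dif_neg h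

theorem A_mem_sliceSpan {i : F.I} {p : ℤ} (h : E.MemIhat i (p - F.d i)) :
    E.A i p ∈ E.sliceSpan :=
  AddSubgroup.mem_sup_left (AddSubgroup.subset_closure ⟨i, p, h, rfl⟩)

/-- All other variables of `A_{i,p}` have heights strictly between those of its two outer ones, so
the relation trades one outer variable for the other. -/
theorem Y_add_Y_mem_sliceSpan {i : F.I} {p : ℤ} (h : E.MemIhat i (p - F.d i))
    (hY : ∀ j q, p - F.d i < q → q < p + F.d i → E.Y j q ∈ E.sliceSpan) :
    E.Y i (p - F.d i) + E.Y i (p + F.d i) ∈ E.sliceSpan := by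
  classical
  have hA := A_mem_sliceSpan h
  have hd := F.d_pos' i
  have h1 : ∑ j with F.c j i = -1, E.Y j p ∈ E.sliceSpan :=
    sum_mem fun j _ => hY j p (by omega) (by omega)
  have h2 : ∑ j with F.c j i = -2, (E.Y j (p - 1) + E.Y j (p + 1)) ∈ E.sliceSpan := by
    refine sum_mem fun j hj => ?_
    have : 1 < F.d i := F.lt_of_c_eq_neg le_rfl (Finset.mem_filter.1 hj).2
    exact add_mem (hY j _ (by omega) (by omega)) (hY j _ (by omega) (by omega))
  have h3 : ∑ j with F.c j i = -3, (E.Y j (p - 2) + E.Y j p + E.Y j (p + 2)) ∈ E.sliceSpan := by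
    refine sum_mem fun j hj => ?_
    have : 2 < F.d i := F.lt_of_c_eq_neg one_le_two (Finset.mem_filter.1 hj).2
    exact add_mem (add_mem (hY j _ (by omega) (by omega)) (hY j _ (by omega) (by omega)))
      (hY j _ (by omega) (by omega))
  have := add_mem (add_mem (add_mem hA h3) h2) h1
  rw [A] at this
  convert this using 1
  abel

/-- Downward recursion on the height, starting from the window `-2 d < p ≤ 0`, which meets the
heights over each vertex exactly once, in the slice. The value zero of `Y` off `Î` allows the
induction to run over all pairs. -/
theorem Y_mem_sliceSpan_of_nonpos (n : ℕ) : ∀ (i : F.I) (p : ℤ), p ≤ 0 → -p = n →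
    E.Y i p ∈ E.sliceSpan := by
  induction n using Nat.strong_induction_on with
  | _ n ih =>
    intro i p hp hn
    by_cases h : E.MemIhat i p
    swap
    · rw [Y_of_not_memIhat h]
      exact zero_mem _
    obtain ⟨v, rfl, hv⟩ := h.exists_isRepVertex
    have hd := F.d_pos v
    by_cases hlt : 0 < p + 2 * F.d (F.orb v)
    · have hl := E.isRepVertex_level 0 v
      have hl1 := E.level_le 0 v
      have hl2 := E.lt_level_add 0 v
      have : p = E.level 0 v := by
        rcases lt_trichotomy p (E.level 0 v) with h1 | h1 | h1
        · have := hl.add_le hv h1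
          omega
        · exact h1
        · have := hv.add_le hl h1
          omega
      rw [this]
      exact AddSubgroup.mem_sup_right (AddSubgroup.subset_closure ⟨v, rfl⟩)
    · have hneg : ∀ j q, p < q → q ≤ 0 → E.Y j q ∈ E.sliceSpan := fun j q h1 h2 =>
        ih (-q).toNat (by omega) j q h2 (by omega)
      have key := Y_add_Y_mem_sliceSpan (E := E) (i := F.orb v) (p := p + F.d (F.orb v))
        (by rwa [add_sub_cancel_right]) fun j q h1 h2 => hneg j q (by omega) (by omega)
      have := sub_mem key (hneg (F.orb v) (p + F.d (F.orb v) + F.d (F.orb v)) (by omega)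
        (by omega))
      rwa [add_sub_cancel_right, add_sub_cancel_right] at this

/-- The same relations, solved for the upper variable, give the positive heights. -/
theorem Y_mem_sliceSpan (n : ℕ) : ∀ (i : F.I) (p : ℤ), p ≤ n → E.Y i p ∈ E.sliceSpan := by
  induction n with
  | zero => exact fun i p hp => Y_mem_sliceSpan_of_nonpos (-p).toNat i p (by simpa using hp) (by
      simp only [Nat.cast_zero] at hp
      omega)
  | succ n ih =>
    intro i p hp
    by_cases h : E.MemIhat i p
    swap
    · rw [Y_of_not_memIhat h]
      exact zero_mem _
    by_cases hle : p ≤ n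
    · exact ih i p hle
    obtain ⟨v, rfl, hv⟩ := h.exists_isRepVertex
    have hd := F.d_pos v
    have hv' : E.IsRepVertex (v, p - F.d (F.orb v) - F.d (F.orb v)) :=
      hv.of_dvd_sub ⟨1, by ring⟩
    have key := Y_add_Y_mem_sliceSpan (E := E) (i := F.orb v) (p := p - F.d (F.orb v))
      hv'.memIhat fun j q h1 h2 => ih j q (by omega)
    have := sub_mem key (ih (F.orb v) (p - F.d (F.orb v) - F.d (F.orb v)) (by omega))
    rwa [add_sub_cancel_left, sub_add_cancel] at this

theorem sliceSpan_eq_top : E.sliceSpan = ⊤ := by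
  rw [eq_top_iff]
  intro m _
  rw [← Finsupp.sum_single m]
  refine sum_mem fun x _ => ?_
  obtain ⟨⟨i, p⟩, hx⟩ := x
  have : Finsupp.single (⟨(i, p), hx⟩ : E.Ihat) (m ⟨(i, p), hx⟩) =
      m ⟨(i, p), hx⟩ • E.Y i p := by
    rw [Y, dif_pos hx]
    simp
  rw [this]
  exact zsmul_mem (Y_mem_sliceSpan p.toNat i p (by omega)) _

/-! ### Image and kernel of the weight homomorphism -/

namespace IsTransportHom

variable {Φ : E.Monomial →+ F.Weight}

theorem apply_Y (hΦ : E.IsTransportHom Φ) {v : V} {p : ℤ} (h : E.IsRepVertex (v, p)) :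
    Φ (E.Y (F.orb v) p) = E.transport p (F.simpleRoot v) := by
  rw [hΦ v p h, E.transport_sub_one_fundWeight h, sub_sub_cancel]

theorem mem_rootLattice (hΦ : E.IsTransportHom Φ) (m : E.Monomial) : Φ m ∈ F.rootLattice := by
  rw [← Finsupp.sum_single m, Finsupp.sum, map_sum]
  refine sum_mem fun x _ => ?_
  obtain ⟨⟨i, p⟩, hx⟩ := x
  obtain ⟨v, rfl, hv⟩ := MemIhat.exists_isRepVertex hx
  have : Finsupp.single (⟨(F.orb v, p), hx⟩ : E.Ihat) (m ⟨(F.orb v, p), hx⟩) =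
      m ⟨(F.orb v, p), hx⟩ • E.Y (F.orb v) p := by
    rw [Y, dif_pos hx]
    simp
  rw [this, map_zsmul, hΦ.apply_Y hv]
  exact zsmul_mem ((E.transport_mem_stabilizer p _).2 (F.simpleRoot_mem_rootLattice v)) _

/-- Consecutive transports of any weight differ by combinations of vectors `transport p α_v` in the
image. Modulo the image `transport p x` therefore agrees with `transport 0 x = x`; take `x = α_v` at
a height over `v`. -/
theorem rootLattice_le_range (hΦ : E.IsTransportHom Φ) : F.rootLattice ≤ Φ.range := by
  classical
  have hstep : ∀ p x, E.transport (p - 1) x - E.transport p x ∈ Φ.range := by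
    intro p x
    rw [E.transport_sub_one, LinearEquiv.mul_apply, ← map_sub, E.layer_apply, sub_sub_cancel_left,
      map_neg, map_sum]
    refine neg_mem (sum_mem fun v hv => ?_)
    rw [map_zsmul]
    have hm : E.transport p (F.simpleRoot v) ∈ Φ.range :=
      ⟨_, hΦ.apply_Y (Finset.mem_filter.1 hv).2⟩
    exact zsmul_mem hm _
  have hall : ∀ p x, E.transport p x - E.transport 0 x ∈ Φ.range := by
    intro p x
    induction p using Int.induction_on with
    | zero => simp
    | succ n ih =>
      have := sub_mem ih (hstep (n + 1) x)
      rw [add_sub_cancel_right] at this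
      convert this using 1
      abel
    | pred n ih =>
      have := add_mem (hstep (-n) x) ih
      convert this using 1
      abel
  rw [Folding.rootLattice, AddSubgroup.closure_le]
  rintro _ ⟨v, rfl⟩
  have h0 : E.transport 0 = 1 := by simpa using E.transport_even 0
  have h1 := hall (E.level 0 v) (F.simpleRoot v)
  have h2 : E.transport (E.level 0 v) (F.simpleRoot v) ∈ Φ.range :=
    ⟨_, hΦ.apply_Y (E.isRepVertex_level 0 v)⟩
  have := sub_mem h2 h1
  rw [sub_sub_cancel, h0] at this
  exact this

theorem subgroupA_le_ker (Q : QDatum F E) (hΦ : E.IsTransportHom Φ) : E.subgroupA ≤ Φ.ker := by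
  rw [subgroupA, AddSubgroup.closure_le]
  rintro _ ⟨i, p, h, rfl⟩
  exact hΦ.map_A Q h

/-- Modulo `ℳ_A` a monomial is a combination of the `|V|` slice variables. Their images generate the
root lattice, of rank `|V|`, so no nontrivial combination is killed. -/
theorem ker_le_subgroupA (Q : QDatum F E) (hΦ : E.IsTransportHom Φ) : Φ.ker ≤ E.subgroupA := by
  intro m hm
  have hker := hΦ.subgroupA_le_ker Q
  have hdecomp : ∀ m : E.Monomial, ∃ a ∈ E.subgroupA, ∃ b : V → ℤ,
      a + ∑ v, b v • E.sliceVar v = m := by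
    intro m
    have : m ∈ E.sliceSpan := by simp [sliceSpan_eq_top]
    obtain ⟨a, ha, y, hy, rfl⟩ := AddSubgroup.mem_sup.1 this
    have hle : AddSubgroup.closure (Set.range E.sliceVar) ≤
        (Fintype.linearCombination ℤ E.sliceVar).toAddMonoidHom.range := by
      rw [AddSubgroup.closure_le]
      rintro _ ⟨v, rfl⟩
      exact ⟨Pi.single v 1, by simp [Fintype.linearCombination_apply_single]⟩
    obtain ⟨b, rfl⟩ := hle hy
    exact ⟨a, ha, b, rfl⟩
  have hmap : ∀ a ∈ E.subgroupA, ∀ b : V → ℤ, Φ (a + ∑ v, b v • E.sliceVar v) =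
      ∑ v, b v • Φ (E.sliceVar v) := by
    intro a ha b
    rw [map_add, (hker ha : Φ a = 0), zero_add, map_sum]
    simp only [map_zsmul]
  obtain ⟨a, ha, b, rfl⟩ := hdecomp m
  have hb : b = 0 := by
    refine F.eq_zero_of_sum_eq_zero (y := fun v => Φ (E.sliceVar v))
      (fun v => hΦ.mem_rootLattice _) (fun x hx => ?_) ((hmap a ha b).symm.trans hm)
    obtain ⟨m, rfl⟩ := hΦ.rootLattice_le_range hx
    obtain ⟨a', ha', b', rfl⟩ := hdecomp m
    rw [hmap a' ha' b']
    exact sum_mem fun v _ => zsmul_mem (AddSubgroup.subset_closure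
      (Set.mem_range_self (f := fun v => Φ (E.sliceVar v)) v)) _
  subst hb
  simpa using ha

end IsTransportHom

end ParityFunction

theorem wt_mem_rootLattice (m : E.Monomial) : Q.wt m ∈ F.rootLattice := by
  obtain ⟨g, hg, hΦ⟩ := Q.exists_isTransportHom
  exact (hg _).1 (hΦ.mem_rootLattice m)

theorem wt_eq_zero_iff (m : E.Monomial) : Q.wt m = 0 ↔ m ∈ E.subgroupA := by
  obtain ⟨g, -, hΦ⟩ := Q.exists_isTransportHom
  rw [← LinearEquiv.map_eq_zero_iff g]
  exact ⟨fun h => hΦ.ker_le_subgroupA Q h, fun h => hΦ.subgroupA_le_ker Q h⟩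

theorem exists_wt_eq {x : F.Weight} (hx : x ∈ F.rootLattice) : ∃ m, Q.wt m = x := by
  obtain ⟨g, hg, hΦ⟩ := Q.exists_isTransportHom
  obtain ⟨m, hm⟩ := hΦ.rootLattice_le_range ((hg x).2 hx)
  exact ⟨m, g.injective hm⟩

/-- The isomorphism `ℳ/ℳ_A ≃ Q` induced by the `𝒬`-weight. -/
noncomputable def wtEquiv : (E.Monomial ⧸ E.subgroupA) ≃+ F.rootLattice :=
  AddEquiv.ofBijective
    (QuotientAddGroup.lift E.subgroupA (Q.wt.codRestrict F.rootLattice Q.wt_mem_rootLattice)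
      fun m hm => Subtype.ext ((Q.wt_eq_zero_iff m).2 hm)) (by
    constructor
    · rw [injective_iff_map_eq_zero]
      intro x hx
      induction x using QuotientAddGroup.induction_on with | _ m =>
      rw [QuotientAddGroup.eq_zero_iff]
      exact (Q.wt_eq_zero_iff m).1 (congrArg Subtype.val hx)
    · rintro ⟨x, hx⟩
      obtain ⟨m, rfl⟩ := Q.exists_wt_eq hx
      exact ⟨m, rfl⟩)

theorem wtEquiv_mk (m : E.Monomial) :
    (Q.wtEquiv (m : E.Monomial ⧸ E.subgroupA) : F.Weight) = Q.wt m := rfl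

end QDatum

theorem mainTheorem9 {V : Type*} [Fintype V] [DecidableEq V] (F : QDatum.Folding V)
    (E : QDatum.ParityFunction F) (Q : QDatum F E) :
    (∀ (i : F.I) (p : ℤ), E.MemIhat i (p - F.d i) → Q.wt (E.A i p) = 0) ∧
    ∃ e : (E.Monomial ⧸ E.subgroupA) ≃+ F.rootLattice,
      (∀ m : E.Monomial, (e (m : E.Monomial ⧸ E.subgroupA) : F.Weight) = Q.wt m) ∧
      ∀ (L : Type*) [AddCommGroup L] [Module QDatum.BaseField L] [Module F.U L]
        [IsScalarTower QDatum.BaseField F.U L], E.IsSimpleC0 L →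
        ∀ χ : E.Monomial ⧸ E.subgroupA,
          E.HasEllipticCharacter L χ ↔ Q.HasWeight L (e χ : F.Weight) := by
  -- The third claim concerns the same occurring monomials on both sides and needs only that the
  -- induced map is injective.
  refine ⟨fun i p h => Q.wt_A h, Q.wtEquiv, Q.wtEquiv_mk, ?_⟩
  intro L _ _ _ _ _ χ
  refine and_congr_right fun _ => forall_congr' fun m => imp_congr_right fun _ => ?_
  rw [← Q.wtEquiv_mk, Subtype.coe_inj, Q.wtEquiv.injective.eq_iff]
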